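/- **Proposition 5.3 (joint limit of $N_t$ and $d(t)$).** Let $\mathbb U=\bigcup_{n\ge 0}\{0,1\}^n$ be the set of finite words on $\{0,1\}$, $|u|$ being the length (depth) of $u$, and let $(E_u)_{u\in\mathbb U}$ be independent $\mathrm{Exp}(1)$ random variables. The fragment $u$ appears at time $b_u=\sum_{v} E_v$, the sum over the strict prefixes $v$ of $u$ (so $b_\emptyset=0$), and at time $b_u+E_u$ it splits into its two children $u0$ and $u1$. The Yule tree at time $t\ge 0$ is $\mathbb T_t=\{u\in\mathbb U: b_u\le t\}$; its set of leaves $\partial\mathbb T_t$ consists of the nodes of $\mathbb T_t$ without strict descendants in $\mathbb T_t$ (almost surely, these are the $u$ with $b_u\le t<b_u+E_u$), and $N_t=\#\,\partial\mathbb T_t$. Let $\eta(t)=\inf\{s>t:\mathbb T_s\ne\mathbb T_t\}$ be the first time of growing after $t$, let $D(t)$ be the node of the coming insertion, that is, the (almost surely unique) leaf of $\mathbb T_t$ such that $D(t)0$ and $D(t)1$ belong to $\mathbb T_{\eta(t)}$, and let $d(t)=|D(t)|$ be its depth. Then, as $t\to\infty$, $$\left(N_t e^{-t},\ \frac{d(t)-2t}{\sqrt{2t}}\right)\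 \Longrightarrow\ (\xi,G)\qquad\text{in law},$$ where $\xi\sim\mathrm{Exp}(1)$ and $G\sim\mathcal N(0,1)$ are independent. -/

import Mathlib

open Filter MeasureTheory ProbabilityTheory

namespace YuleTree

/-- Finite words on the alphabet `{0, 1}`: the nodes of the infinite binary tree. The root is `[]`,
the children of `u` are `u ++ [false]` and `u ++ [true]`, and the depth of `u` is `u.length`. -/
abbrev Word : Type := List Bool

/-- The leaves of a tree: the nodes that have no (strict) descendant in the tree. -/
def leaves (T : Set Word) : Set Word :=
  {u | u ∈ T ∧ ∀ v : Word, v ≠ [] → u ++ v ∉ T}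

variable {Ω : Type*}

/-- The time at which the fragment `u` appears, when each fragment `v` lives for the duration
`life v` and then splits into its two children: the sum of the lifetimes of the strict ancestors
(the strict prefixes) of `u`. -/
def birthTime (life : Word → Ω → ℝ) (u : Word) (ω : Ω) : ℝ :=
  ∑ i ∈ Finset.range u.length, life (u.take i) ω

/-- The Yule tree at time `t`: the nodes whose fragment has appeared by time `t`. Its leaves are the
fragments present at time `t`, and its internal nodes are the fragments which have already split. -/
def tree (life : Word → Ω → ℝ) (t : ℝ) (ω : Ω) : Set Word :=
  {u | birthTime life u ω ≤ t}

/-- `N_t`, the number of leaves of the Yule tree at time `t`. -/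
noncomputable def numLeaves (life : Word → Ω → ℝ) (t : ℝ) (ω : Ω) : ℕ :=
  (leaves (tree life t ω)).ncard

/-- `η(t)`, the first time of growing after `t`. -/
noncomputable def nextGrowth (life : Word → Ω → ℝ) (t : ℝ) (ω : Ω) : ℝ :=
  sInf {s | t < s ∧ tree life s ω ≠ tree life t ω}

/-- The node of the coming insertion after time `t`, as a set: the leaves of the tree at time `t`
whose two children belong to the tree at time `η(t)`. When the lifetimes are independent `Exp(1)`
random variables and `t ≥ 0`, this set is almost surely a singleton `{D(t)}`. -/
def insertionNode (life : Word → Ω → ℝ) (t : ℝ) (ω : Ω) : Set Word :=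
  {u | u ∈ leaves (tree life t ω) ∧
    u ++ [false] ∈ tree life (nextGrowth life t ω) ω ∧
    u ++ [true] ∈ tree life (nextGrowth life t ω) ω}

/-- `d(t) = |D(t)|`, the depth of the node of the coming insertion (the infimum is over the depths
of the elements of `insertionNode`, almost surely a singleton). -/
noncomputable def insertionDepth (life : Word → Ω → ℝ) (t : ℝ) (ω : Ω) : ℕ :=
  sInf (List.length '' insertionNode life t ω)

end YuleTree

namespace YuleTree

/-! The proof computes the joint generating function of population size and insertion depth exactly,
then lets $t\to\infty$ in the characteristic function. The engine is the branching property
(`measurePreserving_graft`): given that the root splits at time $e\le t$, the tree at time $t$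
consists of two independent copies at age $t-e$. Call a period quiet if no fragment alive at its
start splits before its end. By memorylessness, $k$ fragments stay quiet for a duration $r$ with
probability $e^{-rk}$, and the population is geometric, so $E[s^{N_t};\text{quiet for } r]$ is the
Yule generating function $f_\sigma(t)$ at $\sigma=se^{-r}$ (`integral_pow_pop_quiet`). For a word
$u$ to split first, with delay $r$ after $t$, every sibling subtree hanging off the path to $u$ must
be quiet for $r$. Each such subtree contributes a factor $f_\sigma$ at its age, and integrating over
the ordered branching times gives $\Lambda^{|u|}/|u|!$, where $\Lambda=\int_0^t
f_\sigma=-\log(1-\sigma(1-e^{-t}))$ (`integral_pow_pop_splitsFirst`). Summing $z^{|u|}$ over the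
$2^n$ words of each length $n$ yields $e^{2z\Lambda}$, whose integral over $r$ is elementary
(`jointPGF_eq`):
$$E[s^{N_t}z^{d(t)}]=\frac{e^{-t}\left(e^{(2z-1)\Lambda(s,t)}-1\right)}{(2z-1)(1-e^{-t})}.$$ With
$s=e^{iae^{-t}}$ and $z=e^{ib/\sqrt{2t}}$ one has $\Lambda(s,t)=t-\log w$ with $w\to 1-ia$. The
centred expression therefore behaves like $e^{(2z-2)t-ib\sqrt{2t}}\,w^{-1}\to
e^{-b^2/2}(1-ia)^{-1}$, the product of the Gaussian and exponential characteristic functions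
(`tendsto_jointPGF`). Lévy's continuity theorem concludes. -/

/-! ### The law of the lifetimes and its self-similarity at the root. -/

instance isProbabilityMeasure_expMeasure_one : IsProbabilityMeasure (expMeasure 1) :=
  isProbabilityMeasure_expMeasure one_pos

/-- The law of a family of independent standard exponential lifetimes indexed by the words. -/
noncomputable def lifeMeasure : Measure (Word → ℝ) :=
  Measure.infinitePi fun _ => expMeasure 1

instance : IsProbabilityMeasure lifeMeasure := by
  unfold lifeMeasure; infer_instance

/-- The family of lifetimes with root lifetime `e` and subtrees `a` and `b`. -/
def graft (e : ℝ) (a b : Word → ℝ) : Word → ℝ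
  | [] => e
  | false :: u => a u
  | true :: u => b u

@[simp] lemma graft_nil (e : ℝ) (a b : Word → ℝ) : graft e a b [] = e := rfl

@[simp] lemma graft_cons (e : ℝ) (a b : Word → ℝ) (i : Bool) (u : Word) :
    graft e a b (i :: u) = (bif i then b else a) u := by
  cases i <;> rfl

lemma measurable_graft :
    Measurable fun p : ℝ × (Word → ℝ) × (Word → ℝ) => graft p.1 p.2.1 p.2.2 := by
  refine measurable_pi_iff.2 fun u => ?_
  rcases u with _ | ⟨i, u⟩
  · exact measurable_fst
  · cases i
    · exact (measurable_pi_apply u).comp (measurable_fst.comp measurable_snd)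
    · exact (measurable_pi_apply u).comp (measurable_snd.comp measurable_snd)

/-- A word is empty, starts with `false` or starts with `true`: these are the three fibres of
`List.head?`. -/
lemma prod_word_eq {M : Type*} [CommMonoid M] (s : Finset Word) (f : Word → M) :
    ∏ u ∈ s, f u = (if [] ∈ s then f [] else 1) *
      ((∏ u ∈ s.preimage (List.cons false) List.cons_injective.injOn, f (false :: u)) *
        ∏ u ∈ s.preimage (List.cons true) List.cons_injective.injOn, f (true :: u)) := by
  classical
  have key (i : Bool) : ∏ u ∈ s with u.head? = some i, f u =
      ∏ u ∈ s.preimage (List.cons i) List.cons_injective.injOn, f (i :: u) := by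
    rw [Finset.prod_preimage']
    refine Finset.prod_congr (Finset.filter_congr fun u _ => ?_) fun _ _ => rfl
    rcases u with _ | ⟨j, u⟩ <;> simp [eq_comm]
  have knil : ∏ u ∈ s with u.head? = none, f u = if [] ∈ s then f [] else 1 := by
    simp only [List.head?_eq_none_iff, Finset.prod_filter, Finset.prod_ite_eq']
  rw [← Finset.prod_fiberwise s List.head? f, Fintype.prod_option, Fintype.prod_bool, knil, key,
    key, mul_comm (∏ u ∈ s.preimage (List.cons true) _, _)]

/-- The branching property. An infinite product measure is characterised by its values on finite
boxes, and the preimage of a box is the product of a root constraint and one box per subtree. -/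
lemma measurePreserving_graft :
    MeasurePreserving (fun p : ℝ × (Word → ℝ) × (Word → ℝ) => graft p.1 p.2.1 p.2.2)
      ((expMeasure 1).prod (lifeMeasure.prod lifeMeasure)) lifeMeasure := by
  refine ⟨measurable_graft, Measure.eq_infinitePi _ fun s t ht => ?_⟩
  rw [Measure.map_apply measurable_graft (.pi s.countable_toSet fun i _ => ht i)]
  have : (fun p : ℝ × (Word → ℝ) × (Word → ℝ) => graft p.1 p.2.1 p.2.2) ⁻¹' (Set.pi s t) =
      (if [] ∈ s then t [] else Set.univ) ×ˢ
        (Set.pi (s.preimage (List.cons false) List.cons_injective.injOn) (fun u => t (false :: u)) ×ˢ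
        Set.pi (s.preimage (List.cons true) List.cons_injective.injOn)
          (fun u => t (true :: u))) := by
    ext ⟨e, a, b⟩
    simp only [Set.mem_preimage, Set.mem_pi, Set.mem_prod, Finset.mem_coe, Finset.mem_preimage]
    constructor
    · intro h
      refine ⟨?_, fun u hu => h _ hu, fun u hu => h _ hu⟩
      split_ifs with h0
      · exact h _ h0
      · trivial
    · rintro ⟨h0, h1, h2⟩ (_ | ⟨_ | _, u⟩) hu
      · simpa [hu] using h0
      · exact h1 u hu
      · exact h2 u hu
  rw [this, Measure.prod_prod, Measure.prod_prod, lifeMeasure,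
    Measure.infinitePi_pi _ fun i _ => ht _, Measure.infinitePi_pi _ fun i _ => ht _,
    prod_word_eq s]
  congr 1
  split_ifs <;> simp

/-! ### Birth times, splitting times and living fragments. -/

/-- The time of birth of `u` as a function of the lifetimes. -/
noncomputable abbrev birth (u : Word) (x : Word → ℝ) : ℝ :=
  birthTime (fun v (y : Word → ℝ) => y v) u x

/-- The time at which the fragment `u` splits. -/
noncomputable abbrev split (u : Word) (x : Word → ℝ) : ℝ := birth u x + x u

@[simp] lemma birth_nil (x : Word → ℝ) : birth [] x = 0 := by simp [birth, birthTime]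

@[fun_prop]
lemma measurable_birth (u : Word) : Measurable (birth u) := by
  unfold birth birthTime
  fun_prop

@[fun_prop]
lemma measurable_split (u : Word) : Measurable (split u) := by
  unfold split; fun_prop

@[simp] lemma birth_graft_cons (e : ℝ) (a b : Word → ℝ) (i : Bool) (u : Word) :
    birth (i :: u) (graft e a b) = e + birth u (bif i then b else a) := by
  simp only [birth, birthTime, List.length_cons, Finset.sum_range_succ', List.take_succ_cons,
    graft_cons, List.take_zero, graft_nil]
  ring

@[simp] lemma split_graft_cons (e : ℝ) (a b : Word → ℝ) (i : Bool) (u : Word) :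
    split (i :: u) (graft e a b) = e + split u (bif i then b else a) := by
  simp [split, add_assoc]

@[simp] lemma split_graft_nil (e : ℝ) (a b : Word → ℝ) : split [] (graft e a b) = e := by
  simp [split]

lemma birth_append_singleton (u : Word) (i : Bool) (x : Word → ℝ) :
    birth (u ++ [i]) x = split u x := by
  simp only [split, birth, birthTime, List.length_append, List.length_singleton,
    Finset.sum_range_succ, List.take_left]
  congr 1
  refine Finset.sum_congr rfl fun j hj => ?_
  rw [List.take_append_of_le_length (Finset.mem_range.1 hj).le]

lemma birth_nonneg {x : Word → ℝ} (hx : ∀ u, 0 < x u) (u : Word) : 0 ≤ birth u x :=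
  Finset.sum_nonneg fun _ _ => (hx _).le

lemma birth_le_birth_append {x : Word → ℝ} (hx : ∀ u, 0 < x u) (u v : Word) :
    birth u x ≤ birth (u ++ v) x := by
  induction v using List.reverseRecOn with
  | nil => simp
  | append_singleton v i ih =>
    rw [← List.append_assoc, birth_append_singleton]
    exact ih.trans (by have := hx (u ++ v); simp only [split]; linarith)

/-- The fragments present at time `t`. -/
def alive (t : ℝ) (x : Word → ℝ) : Set Word := {u | birth u x ≤ t ∧ t < split u x}

/-- No fragment present at time `t` splits before time `t + r`. -/
def Quiet (t r : ℝ) (x : Word → ℝ) : Prop := ∀ v ∈ alive t x, t + r ≤ split v x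

/-- The fragment `u` is present at time `t`, and no fragment present at time `t` splits earlier. -/
def SplitsFirst (t : ℝ) (u : Word) (x : Word → ℝ) : Prop :=
  u ∈ alive t x ∧ Quiet t (split u x - t) x

lemma measurableSet_mem_alive (t : ℝ) (u : Word) : MeasurableSet {x | u ∈ alive t x} :=
  (measurableSet_le (measurable_birth u) measurable_const).inter
    (measurableSet_lt measurable_const (measurable_split u))

lemma measurable_alive (t : ℝ) : Measurable (alive t) :=
  measurable_set_iff.2 fun u => (measurableSet_setOfPred.1 (measurableSet_mem_alive t u))

lemma measurableSet_quiet {α : Type*} [MeasurableSpace α] (t : ℝ) {r : α → ℝ} {f : α → Word → ℝ}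
    (hr : Measurable r) (hf : Measurable f) : MeasurableSet {y | Quiet t (r y) (f y)} := by
  have : {y | Quiet t (r y) (f y)} =
      ⋂ v : Word, (f ⁻¹' {x | v ∈ alive t x})ᶜ ∪ {y | t + r y ≤ split v (f y)} := by
    ext y
    simp only [Quiet, Set.mem_ofPred_eq, Set.mem_iInter, Set.mem_union, Set.mem_compl_iff,
      Set.mem_preimage]
    exact forall_congr' fun v => imp_iff_not_or
  rw [this]
  refine .iInter fun v => ((hf (measurableSet_mem_alive t v)).compl).union ?_
  exact measurableSet_le (by fun_prop) ((measurable_split v).comp hf)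

lemma measurableSet_splitsFirst (t : ℝ) (u : Word) : MeasurableSet {x | SplitsFirst t u x} :=
  (measurableSet_mem_alive t u).inter
    (measurableSet_quiet t ((measurable_split u).sub_const t) measurable_id)

/-- Having at least `n` elements means containing one of the countably many finite sets of
cardinality `n`, a countable union of finite intersections of coordinate events. -/
lemma measurable_encard {α : Type*} [Countable α] : Measurable (Set.encard : Set α → ℕ∞) := by
  have key (n : ℕ) : MeasurableSet {S : Set α | (n : ℕ∞) ≤ S.encard} := by
    have : {S : Set α | (n : ℕ∞) ≤ S.encard} =
        ⋃ F : {F : Finset α // F.card = n}, ⋂ a ∈ F.1, {S : Set α | a ∈ S} := by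
      ext S
      simp only [Set.mem_ofPred_eq, Set.mem_iUnion, Set.mem_iInter]
      constructor
      · intro h
        obtain ⟨F, hFS, hF⟩ := Set.exists_subset_encard_eq h
        have hfin := Set.finite_of_encard_eq_coe hF
        refine ⟨⟨hfin.toFinset, ?_⟩, fun a ha => hFS (hfin.mem_toFinset.1 ha)⟩
        rw [hfin.encard_eq_coe_toFinset_card] at hF
        exact_mod_cast hF
      · rintro ⟨⟨F, rfl⟩, hF⟩
        rw [← Set.encard_coe_eq_coe_finsetCard]
        exact Set.encard_le_encard fun a ha => hF a ha
    rw [this]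
    exact .iUnion fun F => .biInter F.1.countable_toSet fun a _ =>
      measurableSet_setOfPred.2 (measurable_set_mem a)
  refine measurable_to_countable' fun n => ?_
  induction n with
  | top =>
    have : Set.encard ⁻¹' {⊤} = ⋂ n : ℕ, {S : Set α | (n : ℕ∞) ≤ S.encard} := by
      ext S
      simp only [Set.mem_preimage, Set.mem_singleton_iff, Set.mem_iInter, Set.mem_ofPred_eq]
      exact ENat.eq_top_iff_forall_ge
    rw [this]
    exact .iInter key
  | coe n =>
    have : Set.encard ⁻¹' {(n : ℕ∞)} =
        {S : Set α | (n : ℕ∞) ≤ S.encard} \ {S : Set α | ((n + 1 : ℕ) : ℕ∞) ≤ S.encard} := by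
      ext S
      simp only [Set.mem_preimage, Set.mem_singleton_iff, Set.mem_sdiff, Set.mem_ofPred_eq, not_le,
        Nat.cast_add, Nat.cast_one]
      rw [ENat.lt_add_one_iff (ENat.natCast_ne_top n), le_antisymm_iff, and_comm]
    rw [this]
    exact (key n).diff (key (n + 1))

/-! ### Living fragments and quiet periods in a grafted tree. -/

lemma alive_graft_of_le {t e : ℝ} (h : e ≤ t) (a b : Word → ℝ) :
    alive t (graft e a b) =
      List.cons false '' alive (t - e) a ∪ List.cons true '' alive (t - e) b := by
  ext u
  rcases u with _ | ⟨_ | _, u⟩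
  · simp [alive, h]
  · simp [alive, le_sub_iff_add_le', sub_lt_iff_lt_add', -cond_false]
    simp
  · simp [alive, le_sub_iff_add_le', sub_lt_iff_lt_add']

lemma alive_graft_of_lt {t e : ℝ} (ht : 0 ≤ t) (h : t < e) {a b : Word → ℝ}
    (ha : ∀ u, 0 < a u) (hb : ∀ u, 0 < b u) : alive t (graft e a b) = {[]} := by
  ext u
  rcases u with _ | ⟨_ | _, u⟩
  · simp [alive, h, ht]
  · have := birth_nonneg ha u
    simp [alive]; intro; linarith
  · have := birth_nonneg hb u
    simp [alive]; intro; linarith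

lemma encard_alive_graft_of_le {t e : ℝ} (h : e ≤ t) (a b : Word → ℝ) :
    (alive t (graft e a b)).encard = (alive (t - e) a).encard + (alive (t - e) b).encard := by
  rw [alive_graft_of_le h, Set.encard_union_eq, List.cons_injective.encard_image,
    List.cons_injective.encard_image]
  rw [Set.disjoint_left]
  rintro _ ⟨u, -, rfl⟩ ⟨v, -, hv⟩
  simp at hv

lemma quiet_graft_of_le {t e : ℝ} (h : e ≤ t) (r : ℝ) (a b : Word → ℝ) :
    Quiet t r (graft e a b) ↔ Quiet (t - e) r a ∧ Quiet (t - e) r b := by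
  simp only [Quiet, alive_graft_of_le h, Set.mem_union, or_imp, forall_and, Set.forall_mem_image,
    split_graft_cons, cond_true, cond_false]
  have (u : Word) (x : Word → ℝ) : t + r ≤ e + split u x ↔ t - e + r ≤ split u x := by
    constructor <;> intro <;> linarith
  simp only [this]

lemma quiet_graft_of_lt {t e : ℝ} (ht : 0 ≤ t) (h : t < e) (r : ℝ) {a b : Word → ℝ}
    (ha : ∀ u, 0 < a u) (hb : ∀ u, 0 < b u) : Quiet t r (graft e a b) ↔ t + r ≤ e := by
  simp [Quiet, alive_graft_of_lt ht h ha hb]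

lemma measurable_ncard {α : Type*} [Countable α] : Measurable (Set.ncard : Set α → ℕ) :=
  (measurable_from_top (f := ENat.toNat)).comp measurable_encard

/-! ### Integration against the exponential law and conditioning on the root lifetime. -/

lemma integral_expMeasure_one (f : ℝ → ℂ) :
    ∫ e, f e ∂(expMeasure 1) = ∫ e in Set.Ioi 0, (Real.exp (-e) : ℂ) * f e := by
  have h : expMeasure 1 = volume.withDensity (exponentialPDF 1) := rfl
  rw [h, integral_withDensity_eq_integral_toReal_smul
    (f := exponentialPDF 1) (measurable_exponentialPDFReal 1).ennreal_ofReal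
    (ae_of_all _ fun _ => ENNReal.ofReal_lt_top), ← integral_indicator measurableSet_Ioi]
  refine integral_congr_ae ?_
  filter_upwards [Measure.ae_ne volume (0 : ℝ)] with e he
  rw [exponentialPDF_eq]
  rcases lt_or_gt_of_ne he with h | h
  · simp [h.not_ge, h.le]
  · rw [Set.indicator_of_mem (Set.mem_Ioi.2 h), if_pos h.le,
      ENNReal.toReal_ofReal (by positivity)]
    simp

lemma integrable_expMeasure_iff (f : ℝ → ℂ) : Integrable f (expMeasure 1) ↔
    IntegrableOn (fun e => (Real.exp (-e) : ℂ) * f e) (Set.Ioi 0) := by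
  have h : expMeasure 1 = volume.withDensity (exponentialPDF 1) := rfl
  rw [h, integrable_withDensity_iff_integrable_smul'
    (f := exponentialPDF 1) (measurable_exponentialPDFReal 1).ennreal_ofReal
    (ae_of_all _ fun _ => ENNReal.ofReal_lt_top), ← integrable_indicator_iff measurableSet_Ioi]
  refine integrable_congr ?_
  filter_upwards [Measure.ae_ne volume (0 : ℝ)] with e he
  rw [exponentialPDF_eq]
  rcases lt_or_gt_of_ne he with h | h
  · simp [h.not_ge, h.le]
  · rw [Set.indicator_of_mem (Set.mem_Ioi.2 h), if_pos h.le,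
      ENNReal.toReal_ofReal (by positivity)]
    simp

/-- Decomposition of an expectation according to whether the root splits before time `t`. -/
lemma integral_branch {F : (Word → ℝ) → ℂ} (hF : Integrable F lifeMeasure) {t : ℝ} (ht : 0 ≤ t)
    {h k : ℝ → ℂ}
    (hlate : ∀ e, t < e → ∫ p, F (graft e p.1 p.2) ∂(lifeMeasure.prod lifeMeasure) = h e)
    (hearly : ∀ e ∈ Set.Ioc 0 t,
      ∫ p, F (graft e p.1 p.2) ∂(lifeMeasure.prod lifeMeasure) = k (t - e)) :
    ∫ x, F x ∂lifeMeasure = Real.exp (-t) * ((∫ r in Set.Ioi 0, (Real.exp (-r) : ℂ) * h (t + r)) +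
      ∫ v in 0..t, (Real.exp v : ℂ) * k v) := by
  have hint : Integrable (fun z : ℝ × (Word → ℝ) × (Word → ℝ) => F (graft z.1 z.2.1 z.2.2))
      ((expMeasure 1).prod (lifeMeasure.prod lifeMeasure)) :=
    measurePreserving_graft.integrable_comp_of_integrable hF
  have hprod : ∫ x, F x ∂lifeMeasure = ∫ e, ∫ p, F (graft e p.1 p.2)
      ∂(lifeMeasure.prod lifeMeasure) ∂(expMeasure 1) := by
    rw [← integral_prod (fun z : ℝ × (Word → ℝ) × (Word → ℝ) => F (graft z.1 z.2.1 z.2.2)) hint]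
    conv_lhs => rw [← measurePreserving_graft.map_eq]
    exact integral_map measurable_graft.aemeasurable
      (by rw [measurePreserving_graft.map_eq]; exact hF.1)
  rw [hprod, integral_expMeasure_one]
  have hint' := (integrable_expMeasure_iff _).1 hint.integral_prod_left
  have hunion := setIntegral_union Set.Ioc_disjoint_Ioi_same measurableSet_Ioi
    (hint'.mono_set (s := Set.Ioc 0 t) fun e he => he.1) (hint'.mono_set (Set.Ioi_subset_Ioi ht))
  rw [Set.Ioc_union_Ioi_eq_Ioi ht] at hunion
  rw [hunion, mul_add, add_comm]
  congr 1
  -- Memorylessness: the shift `e = t + r` extracts the factor `exp (-t)`.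
  · rw [← integral_indicator measurableSet_Ioi, ← integral_indicator measurableSet_Ioi,
      ← integral_add_left_eq_self _ t, ← integral_const_mul]
    refine integral_congr_ae (ae_of_all _ fun r => ?_)
    by_cases hr : 0 < r
    · have hr' : t < t + r := by linarith
      simp only [Set.indicator_of_mem (Set.mem_Ioi.2 hr), Set.indicator_of_mem (Set.mem_Ioi.2 hr')]
      rw [hlate _ hr', ← mul_assoc, ← Complex.ofReal_mul, ← Real.exp_add, neg_add]
    · have hr' : ¬ t < t + r := by linarith
      simp only [Set.indicator_of_notMem (mt Set.mem_Ioi.1 hr),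
        Set.indicator_of_notMem (mt Set.mem_Ioi.1 hr'), mul_zero]
  · rw [setIntegral_congr_fun measurableSet_Ioc (g := fun e => (Real.exp (-e) : ℂ) * k (t - e))
      fun e he => by simp only; rw [← hearly e he]]
    -- The substitution `v = t - e` turns the splitting time of the root into the age of the two
    -- subtrees at time `t`.
    rw [← intervalIntegral.integral_of_le ht, ← intervalIntegral.integral_const_mul]
    have := intervalIntegral.integral_comp_sub_left (a := 0) (b := t)
      (fun v => (Real.exp (-t) : ℂ) * ((Real.exp v : ℂ) * k v)) t
    rw [sub_self, sub_zero] at this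
    rw [← this]
    refine intervalIntegral.integral_congr fun e _ => ?_
    rw [← mul_assoc, ← Complex.ofReal_mul, ← Real.exp_add]
    ring_nf

/-! ### Almost sure positivity and absence of explosion. -/

lemma ae_pos : ∀ᵐ x ∂lifeMeasure, ∀ u, 0 < x u := by
  refine ae_all_iff.2 fun u => ?_
  have : MeasurePreserving (Function.eval u) lifeMeasure (expMeasure 1) :=
    measurePreserving_eval_infinitePi (fun _ : Word => expMeasure 1) u
  refine this.quasiMeasurePreserving.ae (p := fun y => 0 < y) ?_
  rw [ae_iff]
  have h : expMeasure 1 = volume.withDensity (exponentialPDF 1) := rfl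
  have h1 : {a : ℝ | ¬ 0 < a} = Set.Iic 0 := by ext; simp
  have := lintegral_exponentialPDF_eq_antiDeriv one_pos 0
  rw [h1, h, withDensity_apply _ measurableSet_Iic, this]
  simp

lemma ae_pair {p : (Word → ℝ) → Prop} (hp : ∀ᵐ x ∂lifeMeasure, p x) :
    ∀ᵐ q ∂(lifeMeasure.prod lifeMeasure), p q.1 ∧ p q.2 :=
  (Measure.quasiMeasurePreserving_fst.ae hp).and (Measure.quasiMeasurePreserving_snd.ae hp)

/-- The Laplace transform of `Exp(1)` at `θ` is `1 / (1 + θ)`. Any `θ > 1` would serve below, since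
it beats the growth rate `2` of the number of words; here `θ = 2`. -/
lemma lintegral_exp_neg_two :
    ∫⁻ e, ENNReal.ofReal (Real.exp (-2 * e)) ∂(expMeasure 1) = ENNReal.ofReal (1 / 3) := by
  have h : expMeasure 1 = volume.withDensity (exponentialPDF 1) := rfl
  rw [h, lintegral_withDensity_eq_lintegral_mul _ (f := exponentialPDF 1)
    (measurable_exponentialPDFReal 1).ennreal_ofReal (by fun_prop)]
  have h3 : ∀ᵐ e : ℝ, (exponentialPDF 1 * fun e => ENNReal.ofReal (Real.exp (-2 * e))) e =
      (Set.Ioi 0).indicator (fun e : ℝ => ENNReal.ofReal (Real.exp (-3 * e))) e := by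
    filter_upwards [Measure.ae_ne volume (0 : ℝ)] with e he
    rw [Pi.mul_apply, exponentialPDF_eq]
    rcases lt_or_gt_of_ne he with h | h
    · simp [h.not_ge, h.le]
    · rw [Set.indicator_of_mem (Set.mem_Ioi.2 h), if_pos h.le,
        ← ENNReal.ofReal_mul (by positivity), one_mul, ← Real.exp_add]
      ring_nf
  rw [lintegral_congr_ae h3, lintegral_indicator measurableSet_Ioi,
    ← ofReal_integral_eq_lintegral_ofReal (integrableOn_exp_mul_Ioi (by norm_num) 0)
      (ae_of_all _ fun _ => (Real.exp_pos _).le), integral_exp_mul_Ioi (by norm_num)]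
  norm_num

lemma lintegral_exp_neg_birth (u : Word) :
    ∫⁻ x, ENNReal.ofReal (Real.exp (-2 * birth u x)) ∂lifeMeasure =
      ENNReal.ofReal (1 / 3) ^ u.length := by
  induction u with
  | nil => simp
  | cons i u ih =>
    rw [← measurePreserving_graft.lintegral_comp (by fun_prop)]
    simp only [birth_graft_cons, mul_add, Real.exp_add, ENNReal.ofReal_mul (Real.exp_pos _).le]
    have hm : Measurable fun x => ENNReal.ofReal (Real.exp (-2 * birth u x)) := by fun_prop
    rw [lintegral_prod_mul (f := fun e : ℝ => ENNReal.ofReal (Real.exp (-2 * e)))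
      (g := fun p : (Word → ℝ) × (Word → ℝ) =>
        ENNReal.ofReal (Real.exp (-2 * birth u (bif i then p.2 else p.1)))) (by fun_prop)
        (by cases i <;> simp only [cond_true, cond_false] <;> fun_prop), lintegral_exp_neg_two,
      List.length_cons, pow_succ']
    congr 1
    rw [← ih]
    cases i
    · exact measurePreserving_fst.lintegral_comp hm
    · exact measurePreserving_snd.lintegral_comp hm

/-- The words of length `n` are counted by `2 ^ n`. -/
lemma tsum_word_length (f : ℕ → ENNReal) : ∑' u : Word, f u.length = ∑' n, 2 ^ n * f n := by
  rw [← (Equiv.sigmaFiberEquiv (List.length : Word → ℕ)).tsum_eq, ENNReal.tsum_sigma']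
  refine tsum_congr fun n => ?_
  have h (c : {l : Word // l.length = n}) :
      f ((Equiv.sigmaFiberEquiv (List.length : Word → ℕ)) ⟨n, c⟩).length = f n :=
    congrArg f c.2
  simp_rw [h]
  let : Fintype {l : Word // l.length = n} := inferInstanceAs (Fintype (List.Vector Bool n))
  have : Fintype.card {l : Word // l.length = n} = 2 ^ n := by
    have := card_vector (α := Bool) n
    rwa [Fintype.card_bool] at this
  rw [tsum_fintype, Finset.sum_const, Finset.card_univ, this]
  simp

/-- The series of `exp (-2 * birth u)` over all words has expectation `∑ (2/3) ^ n`, so it is almost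
surely finite, and only finitely many of its terms exceed a given positive level. The null set does
not depend on `t`. -/
lemma ae_finite_tree : ∀ᵐ x ∂lifeMeasure, ∀ t, {u | birth u x ≤ t}.Finite := by
  have h : ∫⁻ x, ∑' u, ENNReal.ofReal (Real.exp (-2 * birth u x)) ∂lifeMeasure ≠ ⊤ := by
    rw [lintegral_tsum fun u => by fun_prop]
    simp_rw [lintegral_exp_neg_birth]
    rw [tsum_word_length fun n => ENNReal.ofReal (1 / 3) ^ n]
    have : (fun n : ℕ => (2 : ENNReal) ^ n * ENNReal.ofReal (1 / 3) ^ n) =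
        fun n => ENNReal.ofReal (2 / 3) ^ n := by
      ext n
      rw [← mul_pow, show (2 : ENNReal) = ENNReal.ofReal 2 by simp,
        ← ENNReal.ofReal_mul (by norm_num)]
      norm_num
    rw [this, ENNReal.tsum_geometric]
    refine ENNReal.inv_ne_top.2 (tsub_pos_of_lt ?_).ne'
    rw [← ENNReal.ofReal_one, ENNReal.ofReal_lt_ofReal_iff one_pos]
    norm_num
  filter_upwards [ae_lt_top (.tsum fun u => by fun_prop) h] with x hx t
  refine (ENNReal.finite_const_le_of_tsum_ne_top hx.ne
    (ε := ENNReal.ofReal (Real.exp (-2 * t))) (by simp [Real.exp_pos])).subset fun u hu => ?_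
  have hu' : birth u x ≤ t := hu
  exact ENNReal.ofReal_le_ofReal (Real.exp_le_exp.2 (by linarith))

/-- A deepest node of the finite tree cannot have split yet, as its children would be deeper. -/
lemma alive_nonempty {t : ℝ} (ht : 0 ≤ t) {x : Word → ℝ} (hf : {u | birth u x ≤ t}.Finite) :
    (alive t x).Nonempty := by
  obtain ⟨u, hu, hmax⟩ := hf.exists_maximalFor List.length _ ⟨[], by simpa using ht⟩
  refine ⟨u, hu, not_le.1 fun hlt => ?_⟩
  have hu' : u ++ [true] ∈ {u | birth u x ≤ t} := by
    simpa only [Set.mem_ofPred_eq, birth_append_singleton] using hlt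
  have := hmax hu'
  simp at this

/-! ### The law of the population on a quiet event. -/

open Classical in
/-- The probability that there are `k` fragments at time `t`, none of which splits before
time `t + r`. -/
noncomputable def popProb (r : ℝ) (k : ℕ) (t : ℝ) : ℂ :=
  ∫ x, (if (alive t x).encard = k ∧ Quiet t r x then 1 else 0) ∂lifeMeasure

lemma measurableSet_encard_quiet (r : ℝ) (k : ℕ) (t : ℝ) :
    MeasurableSet {x | (alive t x).encard = k ∧ Quiet t r x} :=
  ((measurable_encard.comp (measurable_alive t)) (measurableSet_singleton _)).inter
    (measurableSet_quiet t measurable_const measurable_id)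

lemma popProb_zero (r : ℝ) {t : ℝ} (ht : 0 ≤ t) : popProb r 0 t = 0 := by
  rw [popProb, integral_eq_zero_of_ae]
  filter_upwards [ae_finite_tree] with x hx
  have := (alive_nonempty ht (hx t)).ne_empty
  simp [this]

lemma integral_Ioi_exp_neg_mul_ite {r : ℝ} (hr : 0 ≤ r) (p : Prop) [Decidable p] :
    ∫ v in Set.Ioi 0, (Real.exp (-v) : ℂ) * (if p ∧ r ≤ v then 1 else 0) =
      if p then (Real.exp (-r) : ℂ) else 0 := by
  by_cases hp : p
  · have h : ∀ v ∈ Set.Ioi (0 : ℝ), (Real.exp (-v) : ℂ) * (if p ∧ r ≤ v then 1 else 0) =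
        (Set.Ici r).indicator (fun v => (Real.exp (-v) : ℂ)) v := by
      intro v _
      by_cases hv : r ≤ v <;> simp [hp, hv]
    have hset : (Set.Ioi 0 ∩ Set.Ici r : Set ℝ) =ᵐ[volume] Set.Ioi r := by
      have : (Set.Ioi r : Set ℝ) = Set.Ioi 0 ∩ Set.Ioi r := by
        rw [Set.Ioi_inter_Ioi, sup_eq_right.2 hr]
      rw [this]
      exact (ae_eq_refl _).inter Ioi_ae_eq_Ici.symm
    rw [setIntegral_congr_fun measurableSet_Ioi h, setIntegral_indicator measurableSet_Ici,
      setIntegral_congr_set hset, integral_complex_ofReal, integral_exp_neg_Ioi, if_pos hp]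
  · simp [hp]

/-- Pointwise form of the convolution formula. A finite sum in `ℕ∞` forces both summands to be
finite, and at most one term on the right is nonzero. -/
lemma ite_add_eq_sum_antidiagonal (A B : ℕ∞) (p q : Prop) [Decidable p] [Decidable q] (k : ℕ) :
    (if A + B = k ∧ p ∧ q then 1 else 0 : ℂ) = ∑ ij ∈ Finset.HasAntidiagonal.antidiagonal k,
      (if A = ij.1 ∧ p then 1 else 0) * (if B = ij.2 ∧ q then 1 else 0) := by
  by_cases h : A + B = k ∧ p ∧ q
  · obtain ⟨h, hp, hq⟩ := h
    obtain ⟨hA, hB⟩ := WithTop.add_ne_top.1 (h ▸ ENat.natCast_ne_top k)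
    lift A to ℕ using hA
    lift B to ℕ using hB
    norm_cast at h
    rw [Finset.sum_eq_single (A, B)]
    · simp [hp, hq]
      exact_mod_cast h
    · rintro ⟨i, j⟩ - hne
      simp only [Nat.cast_inj, hp, hq, and_true, ne_eq, Prod.mk.injEq] at hne ⊢
      by_cases hi : A = i <;> by_cases hj : B = j <;> simp [hi, hj]
      exact hne ⟨hi.symm, hj.symm⟩
    · simp [h]
  · rw [if_neg h, eq_comm]
    refine Finset.sum_eq_zero fun ij hij => ?_
    rw [Finset.HasAntidiagonal.mem_antidiagonal] at hij
    by_cases h1 : A = ij.1 ∧ p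
    · by_cases h2 : B = ij.2 ∧ q
      · exact absurd ⟨by rw [h1.1, h2.1, ← hij]; norm_cast, h1.2, h2.2⟩ h
      · simp [h2]
    · simp [h1]

/-- If the root outlives `t`, it is the only fragment, and quietness asks that it also outlive `t +
r`. Otherwise the two subtrees are independent, their sizes add up and both must be quiet. -/
lemma popProb_recursion {r : ℝ} (hr : 0 ≤ r) (k : ℕ) {t : ℝ} (ht : 0 ≤ t) :
    popProb r k t = Real.exp (-t) * ((if k = 1 then (Real.exp (-r) : ℂ) else 0) +
      ∫ v in 0..t, (Real.exp v : ℂ) *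
        ∑ ij ∈ Finset.HasAntidiagonal.antidiagonal k, popProb r ij.1 v * popProb r ij.2 v) := by
  classical
  have hmeas (j : ℕ) (v : ℝ) : Measurable
      (fun x : Word → ℝ => (if (alive v x).encard = j ∧ Quiet v r x then 1 else 0 : ℂ)) :=
    Measurable.ite (measurableSet_encard_quiet r j v) measurable_const measurable_const
  have hint (j : ℕ) (v : ℝ) : Integrable
      (fun x : Word → ℝ => (if (alive v x).encard = j ∧ Quiet v r x then 1 else 0 : ℂ))
      lifeMeasure :=
    .of_bound (hmeas j v).aestronglyMeasurable 1 (ae_of_all _ fun x => by split_ifs <;> simp)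
  conv_lhs => rw [popProb]
  rw [integral_branch (hint k t) ht (h := fun e => if k = 1 ∧ t + r ≤ e then 1 else 0)
    (k := fun v => ∑ ij ∈ Finset.HasAntidiagonal.antidiagonal k, popProb r ij.1 v * popProb r ij.2 v)]
  · simp only [add_le_add_iff_left]
    rw [integral_Ioi_exp_neg_mul_ite hr]
  · intro e he
    have : ∀ᵐ p ∂(lifeMeasure.prod lifeMeasure),
        (if (alive t (graft e p.1 p.2)).encard = k ∧ Quiet t r (graft e p.1 p.2) then 1 else 0 : ℂ)
          = if k = 1 ∧ t + r ≤ e then 1 else 0 := by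
      filter_upwards [ae_pair ae_pos] with p hp
      rw [alive_graft_of_lt ht he hp.1 hp.2, quiet_graft_of_lt ht he r hp.1 hp.2,
        Set.encard_singleton]
      congr 2
      norm_cast
      exact propext eq_comm
    rw [integral_congr_ae this]
    simp
  · intro e he
    simp only [popProb, ← integral_prod_mul]
    rw [← integral_finsetSum _ fun ij _ => (hint _ _).mul_prod (hint _ _)]
    congr 1 with p
    rw [encard_alive_graft_of_le he.2, quiet_graft_of_le he.2]
    convert! ite_add_eq_sum_antidiagonal _ _ _ _ k

/-- The population is geometric with parameter `exp (-t)`, and each of the `k + 1` fragments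
independently survives a further `r`. The recursion determines these probabilities by strong
induction on `k`. -/
lemma popProb_succ {r : ℝ} (hr : 0 ≤ r) (k : ℕ) {t : ℝ} (ht : 0 ≤ t) :
    popProb r (k + 1) t =
      (Real.exp (-r * (k + 1)) * (Real.exp (-t) * (1 - Real.exp (-t)) ^ k) : ℝ) := by
  induction k using Nat.strong_induction_on generalizing t with
  | _ k ih =>
  rcases k with _ | k
  · rw [popProb_recursion hr _ ht]
    have : ∫ v in 0..t, (Real.exp v : ℂ) *
        ∑ ij ∈ Finset.HasAntidiagonal.antidiagonal (0 + 1), popProb r ij.1 v * popProb r ij.2 v =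
        ∫ v in 0..t, 0 := by
      refine intervalIntegral.integral_congr fun v hv => ?_
      rw [Set.uIcc_of_le ht] at hv
      simp [Finset.Nat.antidiagonal_succ, popProb_zero r hv.1]
    rw [this]
    simp [mul_comm]
  · rw [popProb_recursion hr _ ht]
    have : ∫ v in 0..t, (Real.exp v : ℂ) *
        ∑ ij ∈ Finset.HasAntidiagonal.antidiagonal (k + 1 + 1), popProb r ij.1 v * popProb r ij.2 v =
        ∫ v in 0..t, ((Real.exp (-r * (k + 2)) * ((k + 1) * (1 - Real.exp (-v)) ^ k *
          Real.exp (-v)) : ℝ) : ℂ) := by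
      refine intervalIntegral.integral_congr fun v hv => ?_
      rw [Set.uIcc_of_le ht] at hv
      -- The two extreme terms involve an empty population and vanish. The other `k + 1` terms all
      -- coincide, so that the integrand is a multiple of the derivative of `(1 - exp (-v)) ^ (k +
      -- 1)`.
      rw [Finset.Nat.antidiagonal_succ_succ', Finset.sum_cons, Finset.sum_cons, Finset.sum_map,
        popProb_zero r hv.1]
      have : ∀ ij ∈ Finset.HasAntidiagonal.antidiagonal k, popProb r (ij.1 + 1) v * popProb r (ij.2 + 1) v =
          ((Real.exp (-r * (k + 2)) * (Real.exp (-v) * Real.exp (-v)) *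
            (1 - Real.exp (-v)) ^ k : ℝ) : ℂ) := by
        rintro ⟨i, j⟩ hij
        rw [Finset.HasAntidiagonal.mem_antidiagonal] at hij
        simp only at hij ⊢
        rw [ih i (by omega) hv.1, ih j (by omega) hv.1, ← Complex.ofReal_mul]
        congr 1
        have h1 : Real.exp (-r * (k + 2)) = Real.exp (-r * (i + 1)) * Real.exp (-r * (j + 1)) := by
          rw [← Real.exp_add, ← hij]; push_cast; ring_nf
        rw [h1, ← hij, pow_add]
        ring
      simp only [Function.Embedding.prodMap, Function.Embedding.coeFn_mk, Prod.map,
        zero_mul, mul_zero, zero_add, Nat.succ_eq_add_one]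
      rw [Finset.sum_congr rfl this, Finset.sum_const, Finset.Nat.card_antidiagonal, nsmul_eq_mul,
        ← Complex.ofReal_natCast, ← Complex.ofReal_mul, ← Complex.ofReal_mul]
      congr 1
      have : Real.exp v * Real.exp (-v) = 1 := by rw [← Real.exp_add]; simp
      push_cast
      linear_combination (k + 1) * (Real.exp (-r * (k + 2)) * Real.exp (-v) *
            (1 - Real.exp (-v)) ^ k) * this
    rw [this, intervalIntegral.integral_ofReal, intervalIntegral.integral_const_mul,
      intervalIntegral.integral_eq_sub_of_hasDerivAt (f := fun v => (1 - Real.exp (-v)) ^ (k + 1))]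
    · simp
      ring_nf
    · intro v _
      have := (((hasDerivAt_id v).neg.exp).const_sub 1).fun_pow (k + 1)
      simpa using this
    · exact Continuous.intervalIntegrable (by fun_prop) _ _

/-! ### The Yule generating function and its primitive. -/

/-- The generating function at `σ` of the number of fragments at time `t`. -/
noncomputable def popPGF (σ : ℂ) (t : ℝ) : ℂ :=
  σ * Real.exp (-t) / (1 - σ * (1 - Real.exp (-t) : ℝ))

/-- The integral over `[0, t]` of `popPGF σ`. -/
noncomputable def popCumulant (σ : ℂ) (t : ℝ) : ℂ :=
  -Complex.log (1 - σ * (1 - Real.exp (-t) : ℝ))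

lemma one_sub_exp_neg_nonneg {t : ℝ} (ht : 0 ≤ t) : 0 ≤ 1 - Real.exp (-t) := by
  simpa using ht

lemma norm_mul_one_sub_exp_le {σ : ℂ} (hσ : ‖σ‖ ≤ 1) {t : ℝ} (ht : 0 ≤ t) :
    ‖σ * (1 - Real.exp (-t) : ℝ)‖ ≤ 1 - Real.exp (-t) := by
  have h := one_sub_exp_neg_nonneg ht
  rw [norm_mul, Complex.norm_of_nonneg h]
  exact mul_le_of_le_one_left h hσ

/-- Keeps the argument of the principal logarithm in the slit plane, so that `popCumulant` is
differentiable. -/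
lemma re_pgf_denom_pos {σ : ℂ} (hσ : ‖σ‖ ≤ 1) {t : ℝ} (ht : 0 ≤ t) :
    0 < (1 - σ * (1 - Real.exp (-t) : ℝ)).re := by
  have h1 := norm_mul_one_sub_exp_le hσ ht
  have h2 := (Complex.re_le_norm (σ * (1 - Real.exp (-t) : ℝ))).trans h1
  have := Real.exp_pos (-t)
  rw [Complex.sub_re, Complex.one_re]
  linarith

lemma pgf_denom_ne_zero {σ : ℂ} (hσ : ‖σ‖ ≤ 1) {t : ℝ} (ht : 0 ≤ t) :
    1 - σ * (1 - Real.exp (-t) : ℝ) ≠ 0 := fun h => by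
  have := re_pgf_denom_pos hσ ht
  rw [h, Complex.zero_re] at this
  exact this.false

lemma norm_popPGF_le {σ : ℂ} (hσ : ‖σ‖ ≤ 1) {t : ℝ} (ht : 0 ≤ t) : ‖popPGF σ t‖ ≤ 1 := by
  rw [popPGF, norm_div, norm_mul, Complex.norm_of_nonneg (Real.exp_pos _).le]
  refine div_le_one_of_le₀ ?_ (norm_nonneg _)
  have h1 := norm_mul_one_sub_exp_le hσ ht
  have h2 := norm_sub_norm_le (1 : ℂ) (σ * (1 - Real.exp (-t) : ℝ))
  rw [norm_one] at h2
  have h3 := mul_le_of_le_one_left (Real.exp_pos (-t)).le hσ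
  linarith

lemma hasDerivAt_popCumulant {σ : ℂ} (hσ : ‖σ‖ ≤ 1) {t : ℝ} (ht : 0 ≤ t) :
    HasDerivAt (popCumulant σ) (popPGF σ t) t := by
  have h1 : HasDerivAt (fun t : ℝ => ((1 - Real.exp (-t) : ℝ) : ℂ)) (Real.exp (-t) : ℝ) t := by
    have := (((hasDerivAt_id t).neg.exp).const_sub 1).ofReal_comp
    simpa using this
  have h2 := (((h1.const_mul σ).const_sub 1).clog_real (.inl (re_pgf_denom_pos hσ ht))).neg
  convert! h2 using 1
  rw [popPGF, neg_div, neg_neg]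

@[simp] lemma popCumulant_zero (σ : ℂ) : popCumulant σ 0 = 0 := by simp [popCumulant]

lemma continuousOn_popCumulant {σ : ℂ} (hσ : ‖σ‖ ≤ 1) (t : ℝ) :
    ContinuousOn (popCumulant σ) (Set.Icc 0 t) := fun _ hv =>
  (hasDerivAt_popCumulant hσ hv.1).continuousAt.continuousWithinAt

lemma continuousOn_popPGF {σ : ℂ} (hσ : ‖σ‖ ≤ 1) (t : ℝ) :
    ContinuousOn (popPGF σ) (Set.Icc 0 t) := by
  unfold popPGF
  exact ContinuousOn.div (by fun_prop) (by fun_prop) fun v hv => pgf_denom_ne_zero hσ hv.1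

/-- It vanishes at `0` and its derivative `popPGF` is bounded by `1`. -/
lemma norm_popCumulant_le {σ : ℂ} (hσ : ‖σ‖ ≤ 1) {t : ℝ} (ht : 0 ≤ t) :
    ‖popCumulant σ t‖ ≤ t := by
  have := norm_image_sub_le_of_norm_deriv_le_segment' (f := popCumulant σ) (a := 0) (b := t)
    (f' := popPGF σ) (C := 1) (fun v hv => (hasDerivAt_popCumulant hσ hv.1).hasDerivWithinAt)
    (fun v hv => norm_popPGF_le hσ hv.1) t ⟨ht, le_rfl⟩
  simpa using this

lemma integral_popPGF_mul_pow {σ : ℂ} (hσ : ‖σ‖ ≤ 1) {t : ℝ} (ht : 0 ≤ t) (n : ℕ) :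
    ∫ v in 0..t, popPGF σ v * (popCumulant σ v ^ n / n.factorial) =
      popCumulant σ t ^ (n + 1) / (n + 1).factorial := by
  rw [intervalIntegral.integral_eq_sub_of_hasDerivAt
    (f := fun v => popCumulant σ v ^ (n + 1) / (n + 1).factorial)]
  · simp
  · intro v hv
    rw [Set.uIcc_of_le ht] at hv
    convert! ((hasDerivAt_popCumulant hσ hv.1).fun_pow (n + 1)).div_const _ using 1
    rw [Nat.factorial_succ]
    have : (n.factorial : ℂ) ≠ 0 := by exact_mod_cast n.factorial_ne_zero
    have : (n + 1 : ℂ) ≠ 0 := by exact_mod_cast n.succ_ne_zero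
    push_cast
    field_simp
  · refine ContinuousOn.intervalIntegrable ?_
    rw [Set.uIcc_of_le ht]
    exact (continuousOn_popPGF hσ t).mul (((continuousOn_popCumulant hσ t).pow n).div_const _)

lemma norm_mul_exp_neg_le {s : ℂ} (hs : ‖s‖ ≤ 1) {r : ℝ} (hr : 0 ≤ r) :
    ‖s * Real.exp (-r)‖ ≤ 1 := by
  rw [norm_mul, Complex.norm_of_nonneg (Real.exp_pos _).le]
  exact mul_le_one₀ hs (Real.exp_pos _).le (by simpa using hr)

/-- The number of fragments at time `t`, as a function of the lifetimes. -/
noncomputable abbrev pop (t : ℝ) (x : Word → ℝ) : ℕ := (alive t x).ncard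

@[fun_prop]
lemma measurable_pop (t : ℝ) : Measurable (pop t) := measurable_ncard.comp (measurable_alive t)

lemma hasSum_of_eq_zero {ι M : Type*} [AddCommMonoid M] [TopologicalSpace M] {f : ι → M} {c : M}
    (m : ι) (h : f m = c) (h0 : ∀ k ≠ m, f k = 0) : HasSum f c :=
  h ▸ hasSum_single m h0

open Classical in
-- Sum of a geometric series over the population sizes. Quietness replaces `s` by `s * exp (-r)`,
-- one factor `exp (-r)` per fragment.
lemma integral_pow_pop_quiet {s : ℂ} (hs : ‖s‖ ≤ 1) {r t : ℝ} (hr : 0 ≤ r) (ht : 0 ≤ t) :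
    ∫ x, s ^ pop t x * (if Quiet t r x then 1 else 0) ∂lifeMeasure =
      popPGF (s * Real.exp (-r)) t := by
  have hsum : HasSum
      (fun k : ℕ => ∫ x, s ^ (k + 1) *
        (if (alive t x).encard = (k + 1 : ℕ) ∧ Quiet t r x then 1 else 0) ∂lifeMeasure)
      (∫ x, s ^ pop t x * (if Quiet t r x then 1 else 0) ∂lifeMeasure) := by
    have hpt : ∀ᵐ x ∂lifeMeasure, ∃ m : ℕ, (alive t x).encard = (m + 1 : ℕ) := by
      filter_upwards [ae_finite_tree] with x hx
      have hfin : (alive t x).Finite := (hx t).subset fun u hu => hu.1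
      have hpos := (Set.ncard_pos hfin).2 (alive_nonempty ht (hx t))
      refine ⟨(alive t x).ncard - 1, ?_⟩
      rw [Nat.sub_add_cancel hpos, hfin.cast_ncard_eq]
    have hsumm : ∀ᵐ x ∂lifeMeasure, HasSum (fun k : ℕ =>
        (if (alive t x).encard = (k + 1 : ℕ) ∧ Quiet t r x then 1 else 0 : ℝ))
        (if Quiet t r x then 1 else 0) := by
      filter_upwards [hpt] with x ⟨m, hm⟩
      refine hasSum_of_eq_zero m ?_ fun k hk => ?_
      · simp [hm]
      · rw [if_neg]
        rintro ⟨h, -⟩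
        rw [hm] at h
        norm_cast at h
        omega
    refine hasSum_integral_of_dominated_convergence
      (fun k x => if (alive t x).encard = (k + 1 : ℕ) ∧ Quiet t r x then 1 else 0) ?_ ?_ ?_ ?_ ?_
    · exact fun k => ((Measurable.ite (measurableSet_encard_quiet r (k + 1) t) measurable_const
        measurable_const).const_mul _).aestronglyMeasurable
    · refine fun k => ae_of_all _ fun x => ?_
      rw [norm_mul, norm_pow]
      refine (mul_le_of_le_one_left (norm_nonneg _) (pow_le_one₀ (norm_nonneg _) hs)).trans ?_
      split_ifs <;> simp
    · exact hsumm.mono fun x hx => hx.summable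
    · refine Integrable.congr (f := fun x => if Quiet t r x then (1 : ℝ) else 0) ?_ ?_
      · refine .of_bound (Measurable.ite (measurableSet_quiet t measurable_const measurable_id)
          measurable_const measurable_const).aestronglyMeasurable 1 (ae_of_all _ fun x => ?_)
        split_ifs <;> simp
      · exact hsumm.mono fun x hx => hx.tsum_eq.symm
    · filter_upwards [hpt] with x ⟨m, hm⟩
      refine hasSum_of_eq_zero m ?_ fun k hk => ?_
      · have : pop t x = m + 1 := by rw [pop, Set.ncard_def, hm]; rfl
        simp [hm, this]
      · rw [if_neg, mul_zero]
        rintro ⟨h, -⟩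
        rw [hm] at h
        norm_cast at h
        omega
  refine hsum.unique ?_
  have hσ : ‖s * Real.exp (-r)‖ ≤ 1 := norm_mul_exp_neg_le hs hr
  have hlt : ‖s * Real.exp (-r) * (1 - Real.exp (-t) : ℝ)‖ < 1 :=
    (norm_mul_one_sub_exp_le hσ ht).trans_lt (by simp [Real.exp_pos])
  rw [popPGF, div_eq_mul_inv]
  convert! (hasSum_geometric_of_norm_lt_one hlt).mul_left (s * Real.exp (-r) * Real.exp (-t))
    using 1
  ext k
  have h := popProb_succ hr k ht
  rw [popProb] at h
  rw [integral_const_mul, h]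
  have : Real.exp (-r * (k + 1)) = Real.exp (-r) ^ (k + 1) := by
    rw [← Real.exp_nat_mul]; push_cast; ring_nf
  rw [this, mul_pow, mul_pow]
  push_cast
  ring

/-! ### The joint law of the population, the first fragment to split and its delay. -/

lemma ncard_alive_graft_of_le {t e : ℝ} (h : e ≤ t) {a b : Word → ℝ}
    (ha : ∀ t, {u | birth u a ≤ t}.Finite) (hb : ∀ t, {u | birth u b ≤ t}.Finite) :
    pop t (graft e a b) = pop (t - e) a + pop (t - e) b := by
  have ha' : (alive (t - e) a).Finite := (ha _).subset fun u hu => hu.1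
  have hb' : (alive (t - e) b).Finite := (hb _).subset fun u hu => hu.1
  rw [pop, Set.ncard_def, encard_alive_graft_of_le h,
    ENat.toNat_add (by simpa using ha') (by simpa using hb')]
  rfl

lemma splitsFirst_graft_of_le {t e : ℝ} (h : e ≤ t) (a b : Word → ℝ) (i : Bool) (u : Word) :
    SplitsFirst t (i :: u) (graft e a b) ↔ SplitsFirst (t - e) u (bif i then b else a) ∧
      Quiet (t - e) (split u (bif i then b else a) - (t - e)) (bif i then a else b) := by
  have h1 : e + split u (bif i then b else a) - t = split u (bif i then b else a) - (t - e) := by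
    ring
  rw [SplitsFirst, SplitsFirst, alive_graft_of_le h, quiet_graft_of_le h, split_graft_cons, h1]
  cases i
  · simp [and_assoc]
  · simp only [cond_true]
    simp [and_comm]
    tauto

lemma SplitsFirst.lt_split {t : ℝ} {u : Word} {x : Word → ℝ} (h : SplitsFirst t u x) :
    0 < split u x - t := sub_pos.2 h.1.2

open Classical in
-- The sibling subtree is independent of the one containing `u`, so it is integrated out first, with
-- the splitting delay of `u` frozen. What remains is a single-tree integral with a new test
-- function of the delay.
lemma integral_pow_pop_splitsFirst_prod {s : ℂ} (hs : ‖s‖ ≤ 1) {g : ℝ → ℂ} (hg : Measurable g)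
    (hb : ∀ r, 0 ≤ r → ‖g r‖ ≤ 1) {v : ℝ} (hv : 0 ≤ v) (u : Word) :
    ∫ p, s ^ pop v p.1 * (if SplitsFirst v u p.1 then g (split u p.1 - v) else 0) *
      (s ^ pop v p.2 * (if Quiet v (split u p.1 - v) p.2 then 1 else 0))
        ∂(lifeMeasure.prod lifeMeasure) =
    ∫ x, s ^ pop v x * (if SplitsFirst v u x then
      g (split u x - v) * popPGF (s * Real.exp (-(split u x - v))) v else 0) ∂lifeMeasure := by
  rw [integral_prod]
  · refine integral_congr_ae (ae_of_all _ fun a => ?_)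
    simp only
    rw [integral_const_mul]
    by_cases h : SplitsFirst v u a
    · rw [integral_pow_pop_quiet hs h.lt_split.le hv, if_pos h, if_pos h, mul_assoc]
    · simp [h]
  · refine .of_bound (Measurable.aestronglyMeasurable ?_) 1 (ae_of_all _ fun p => ?_)
    · have hS : MeasurableSet
          {p : (Word → ℝ) × (Word → ℝ) | SplitsFirst v u p.1} :=
        measurable_fst (measurableSet_splitsFirst v u)
      have hQ : MeasurableSet
          {p : (Word → ℝ) × (Word → ℝ) | Quiet v (split u p.1 - v) p.2} :=
        measurableSet_quiet v (by fun_prop) measurable_snd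
      have h1 : Measurable fun p : (Word → ℝ) × (Word → ℝ) =>
          if SplitsFirst v u p.1 then g (split u p.1 - v) else 0 :=
        Measurable.ite hS (by fun_prop) measurable_const
      have h2 : Measurable fun p : (Word → ℝ) × (Word → ℝ) =>
          if Quiet v (split u p.1 - v) p.2 then (1 : ℂ) else 0 :=
        Measurable.ite hQ measurable_const measurable_const
      have h3 : Measurable fun p : (Word → ℝ) × (Word → ℝ) => s ^ pop v p.1 :=
        (measurable_from_top (f := fun n : ℕ => s ^ n)).comp ((measurable_pop v).comp measurable_fst)
      have h4 : Measurable fun p : (Word → ℝ) × (Word → ℝ) => s ^ pop v p.2 :=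
        (measurable_from_top (f := fun n : ℕ => s ^ n)).comp ((measurable_pop v).comp measurable_snd)
      exact (h3.mul h1).mul (h4.mul h2)
    · simp only [norm_mul, norm_pow]
      have h1 : ‖(if SplitsFirst v u p.1 then g (split u p.1 - v) else 0)‖ ≤ 1 := by
        split_ifs with h
        · exact hb _ h.lt_split.le
        · simp
      have h2 : ‖(if Quiet v (split u p.1 - v) p.2 then (1 : ℂ) else 0)‖ ≤ 1 := by
        split_ifs <;> simp
      have h3 (n : ℕ) : ‖s‖ ^ n ≤ 1 := pow_le_one₀ (norm_nonneg _) hs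
      exact mul_le_one₀ (mul_le_one₀ (h3 _) (norm_nonneg _) h1) (by positivity)
        (mul_le_one₀ (h3 _) (norm_nonneg _) h2)

lemma measurable_popPGF_mul_exp (s : ℂ) :
    Measurable fun p : ℝ × ℝ => popPGF (s * Real.exp (-p.2)) p.1 := by
  unfold popPGF; fun_prop

lemma measurable_popCumulant_mul_exp (s : ℂ) :
    Measurable fun p : ℝ × ℝ => popCumulant (s * Real.exp (-p.2)) p.1 := by
  unfold popCumulant; fun_prop

lemma integrableOn_exp_neg_mul {f : ℝ → ℂ} (hf : Measurable f) {C : ℝ}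
    (hC : ∀ r, 0 < r → ‖f r‖ ≤ C) :
    IntegrableOn (fun r => (Real.exp (-r) : ℂ) * f r) (Set.Ioi 0) := by
  refine Integrable.mono' (g := fun r => Real.exp (-r) * C) ?_ (by fun_prop) ?_
  · have := integrableOn_exp_mul_Ioi (a := -1) (by norm_num) 0
    simp only [neg_mul, one_mul] at this
    exact this.mul_const C
  · refine ae_restrict_of_forall_mem measurableSet_Ioi fun r hr => ?_
    rw [norm_mul, Complex.norm_of_nonneg (Real.exp_pos _).le]
    exact mul_le_mul_of_nonneg_left (hC r hr) (Real.exp_pos _).le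

lemma norm_cumulant_term_le {σ : ℂ} (hσ : ‖σ‖ ≤ 1) {t : ℝ} (ht : 0 ≤ t) (n : ℕ) :
    ‖popCumulant σ t ^ n / n.factorial‖ ≤ t ^ n / n.factorial := by
  rw [norm_div, norm_pow, Complex.norm_natCast]
  gcongr
  exact norm_popCumulant_le hσ ht

/-- After Fubini, the integral over the age `v` is that of `Λ' Λ ^ n / n!`, which raises the divided
power by one. -/
lemma intervalIntegral_integral_cumulant {s : ℂ} (hs : ‖s‖ ≤ 1) {g : ℝ → ℂ} (hg : Measurable g)
    (hb : ∀ r, 0 ≤ r → ‖g r‖ ≤ 1) {t : ℝ} (ht : 0 ≤ t) (n : ℕ) :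
    ∫ v in 0..t, ∫ r in Set.Ioi 0, (Real.exp (-r) : ℂ) *
      ((g r * popPGF (s * Real.exp (-r)) v) *
        (popCumulant (s * Real.exp (-r)) v ^ n / n.factorial)) =
    ∫ r in Set.Ioi 0, (Real.exp (-r) : ℂ) *
      (g r * (popCumulant (s * Real.exp (-r)) t ^ (n + 1) / (n + 1).factorial)) := by
  rw [intervalIntegral.integral_of_le ht, integral_integral_swap]
  · refine setIntegral_congr_fun measurableSet_Ioi fun r hr => ?_
    have hr' : 0 ≤ r := (Set.mem_Ioi.1 hr).le
    rw [← integral_popPGF_mul_pow (norm_mul_exp_neg_le hs hr') ht n,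
      ← intervalIntegral.integral_of_le ht, ← intervalIntegral.integral_const_mul,
      ← intervalIntegral.integral_const_mul]
    refine intervalIntegral.integral_congr fun v _ => ?_
    ring
  · have hdom : Integrable (fun p : ℝ × ℝ => (t ^ n / n.factorial) * Real.exp (-p.2))
        ((volume.restrict (Set.Ioc 0 t)).prod (volume.restrict (Set.Ioi 0))) := by
      have := integrableOn_exp_mul_Ioi (a := -1) (by norm_num) 0
      simp only [neg_mul, one_mul] at this
      exact (integrable_const (t ^ n / (n.factorial : ℝ))).mul_prod this
    refine hdom.mono' (Measurable.aestronglyMeasurable ?_) ?_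
    · have h1 := measurable_popPGF_mul_exp s
      have h2 := measurable_popCumulant_mul_exp s
      simp only [Function.uncurry_def]
      fun_prop
    · rw [Measure.prod_restrict]
      refine ae_restrict_of_forall_mem (measurableSet_Ioc.prod measurableSet_Ioi) ?_
      rintro ⟨v, r⟩ ⟨hv, hr⟩
      have hr' : 0 ≤ r := (Set.mem_Ioi.1 hr).le
      have hσ := norm_mul_exp_neg_le hs hr'
      have h1 := norm_popPGF_le hσ hv.1.le
      have h2 := norm_cumulant_term_le hσ hv.1.le n
      have h3 : v ^ n / (n.factorial : ℝ) ≤ t ^ n / n.factorial := by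
        gcongr
        · exact hv.1.le
        · exact hv.2
      simp only [Function.uncurry_apply_pair]
      rw [norm_mul, norm_mul, norm_mul, Complex.norm_of_nonneg (Real.exp_pos _).le, mul_comm]
      gcongr
      calc _ ≤ 1 * (t ^ n / n.factorial) := by
            refine mul_le_mul (mul_le_one₀ (hb r hr') (norm_nonneg _) h1) (h2.trans h3)
              (norm_nonneg _) zero_le_one
        _ = _ := one_mul _

open Classical in
lemma integrable_pow_pop_splitsFirst {s : ℂ} (hs : ‖s‖ ≤ 1) (u : Word) {g : ℝ → ℂ}
    (hg : Measurable g) (hb : ∀ r, 0 ≤ r → ‖g r‖ ≤ 1) (t : ℝ) :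
    Integrable (fun x => s ^ pop t x * (if SplitsFirst t u x then g (split u x - t) else 0))
      lifeMeasure := by
  refine .of_bound (Measurable.aestronglyMeasurable ?_) 1 (ae_of_all _ fun x => ?_)
  · have h1 : Measurable fun x => if SplitsFirst t u x then g (split u x - t) else 0 :=
      Measurable.ite (measurableSet_splitsFirst t u) (by fun_prop) measurable_const
    exact ((measurable_from_top (f := fun n : ℕ => s ^ n)).comp (measurable_pop t)).mul h1
  · rw [norm_mul, norm_pow]
    refine mul_le_one₀ (pow_le_one₀ (norm_nonneg _) hs) (norm_nonneg _) ?_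
    split_ifs with h
    · exact hb _ h.lt_split.le
    · simp

open Classical in
/-- The joint law of the size of the population, of the first fragment to split after time `t` and
of the time it takes to split. -/
lemma integral_pow_pop_splitsFirst {s : ℂ} (hs : ‖s‖ ≤ 1) (u : Word) {g : ℝ → ℂ}
    (hg : Measurable g) (hb : ∀ r, 0 ≤ r → ‖g r‖ ≤ 1) {t : ℝ} (ht : 0 ≤ t) :
    ∫ x, s ^ pop t x * (if SplitsFirst t u x then g (split u x - t) else 0) ∂lifeMeasure =
      s * Real.exp (-t) * ∫ r in Set.Ioi 0, (Real.exp (-r) : ℂ) *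
        (g r * (popCumulant (s * Real.exp (-r)) t ^ u.length / u.length.factorial)) := by
  induction u generalizing g t with
  | nil =>
    -- The root splits first exactly when it outlives `t`; the population is then `1` and the delay
    -- is `e - t`.
    rw [integral_branch (integrable_pow_pop_splitsFirst hs [] hg hb t) ht (h := fun e => s * g (e - t)) (k := fun _ => 0)]
    · simp only [mul_zero, intervalIntegral.integral_zero, add_zero, add_sub_cancel_left,
        List.length_nil, pow_zero, Nat.factorial_zero, Nat.cast_one, div_one, mul_one]
      rw [mul_comm s, mul_assoc, ← integral_const_mul s]
      congr 2 with r
      ring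
    · intro e he
      have : ∀ᵐ p ∂(lifeMeasure.prod lifeMeasure), s ^ pop t (graft e p.1 p.2) *
          (if SplitsFirst t [] (graft e p.1 p.2) then g (split [] (graft e p.1 p.2) - t) else 0) =
          s * g (e - t) := by
        filter_upwards [ae_pair ae_pos] with p hp
        have h1 := alive_graft_of_lt ht he hp.1 hp.2
        have h2 : SplitsFirst t [] (graft e p.1 p.2) := by
          rw [SplitsFirst, h1, quiet_graft_of_lt ht he _ hp.1 hp.2]
          simp
        rw [if_pos h2, split_graft_nil, pop, h1, Set.ncard_singleton, pow_one]
      rw [integral_congr_ae this]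
      simp
    · intro e he
      have (p : (Word → ℝ) × (Word → ℝ)) : ¬ SplitsFirst t [] (graft e p.1 p.2) := by
        rintro ⟨h, -⟩
        simp [alive_graft_of_le he.2] at h
      simp [this]
  | cons i u ih =>
    -- The induction hypothesis is applied to `g` multiplied by the contribution of the sibling
    -- subtree. This is why an arbitrary bounded test function of the delay is carried along.
    have hg' (v : ℝ) : Measurable fun r => g r * popPGF (s * Real.exp (-r)) v := by
      have h : Measurable fun r : ℝ => popPGF (s * Real.exp (-r)) v := by
        unfold popPGF; fun_prop
      exact hg.mul h
    have hb' {v : ℝ} (hv : 0 ≤ v) (r : ℝ) (hr : 0 ≤ r) :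
        ‖g r * popPGF (s * Real.exp (-r)) v‖ ≤ 1 := by
      rw [norm_mul]
      exact mul_le_one₀ (hb r hr) (norm_nonneg _)
        (norm_popPGF_le (norm_mul_exp_neg_le hs hr) hv)
    rw [integral_branch (integrable_pow_pop_splitsFirst hs (i :: u) hg hb t) ht (h := fun e => 0)
      (k := fun v => s * Real.exp (-v) * ∫ r in Set.Ioi 0, (Real.exp (-r) : ℂ) *
        ((g r * popPGF (s * Real.exp (-r)) v) *
          (popCumulant (s * Real.exp (-r)) v ^ u.length / u.length.factorial)))]
    · have : ∫ v in 0..t, (Real.exp v : ℂ) * (s * Real.exp (-v) *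
          ∫ r in Set.Ioi 0, (Real.exp (-r) : ℂ) * ((g r * popPGF (s * Real.exp (-r)) v) *
          (popCumulant (s * Real.exp (-r)) v ^ u.length / u.length.factorial))) =
          s * ∫ v in 0..t, ∫ r in Set.Ioi 0, (Real.exp (-r) : ℂ) *
          ((g r * popPGF (s * Real.exp (-r)) v) *
          (popCumulant (s * Real.exp (-r)) v ^ u.length / u.length.factorial)) := by
        rw [← intervalIntegral.integral_const_mul]
        refine intervalIntegral.integral_congr fun v _ => ?_
        have hv : (Real.exp v : ℂ) * Real.exp (-v) = 1 := by
          rw [← Complex.ofReal_mul, ← Real.exp_add]; simp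
        linear_combination (s * ∫ r in Set.Ioi 0, (Real.exp (-r) : ℂ) *
          ((g r * popPGF (s * Real.exp (-r)) v) *
          (popCumulant (s * Real.exp (-r)) v ^ u.length / u.length.factorial))) * hv
      rw [this, intervalIntegral_integral_cumulant hs hg hb ht]
      simp only [mul_zero, integral_zero, zero_add, List.length_cons]
      ring
    · intro e he
      rw [integral_eq_zero_of_ae]
      filter_upwards [ae_pair ae_pos] with p hp
      have : ¬ SplitsFirst t (i :: u) (graft e p.1 p.2) := by
        rintro ⟨h, -⟩
        simp [alive_graft_of_lt ht he hp.1 hp.2] at h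
      simp [this]
    · intro e he
      have hv : 0 ≤ t - e := sub_nonneg.2 he.2
      rw [← ih (hg' (t - e)) (hb' hv) hv,
        ← integral_pow_pop_splitsFirst_prod hs hg hb hv]
      have key : ∀ᵐ p ∂(lifeMeasure.prod lifeMeasure), s ^ pop t (graft e p.1 p.2) *
          (if SplitsFirst t (i :: u) (graft e p.1 p.2) then
            g (split (i :: u) (graft e p.1 p.2) - t) else 0) =
          s ^ pop (t - e) (bif i then p.2 else p.1) *
            (if SplitsFirst (t - e) u (bif i then p.2 else p.1) then
              g (split u (bif i then p.2 else p.1) - (t - e)) else 0) *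
          (s ^ pop (t - e) (bif i then p.1 else p.2) *
            (if Quiet (t - e) (split u (bif i then p.2 else p.1) - (t - e))
              (bif i then p.1 else p.2) then 1 else 0)) := by
        filter_upwards [ae_pair ae_finite_tree] with p hp
        have hpow : s ^ pop t (graft e p.1 p.2) = s ^ pop (t - e) (bif i then p.2 else p.1) *
            s ^ pop (t - e) (bif i then p.1 else p.2) := by
          rw [ncard_alive_graft_of_le he.2 hp.1 hp.2, ← pow_add]
          cases i
          · rfl
          · rw [add_comm]; rfl
        have h1 : split (i :: u) (graft e p.1 p.2) - t =
            split u (bif i then p.2 else p.1) - (t - e) := by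
          rw [split_graft_cons]; ring
        rw [hpow, h1, if_congr (splitsFirst_graft_of_le he.2 p.1 p.2 i u) rfl rfl]
        by_cases hA : SplitsFirst (t - e) u (bif i then p.2 else p.1)
        · by_cases hB : Quiet (t - e) (split u (bif i then p.2 else p.1) - (t - e))
              (bif i then p.1 else p.2)
          · rw [if_pos ⟨hA, hB⟩, if_pos hA, if_pos hB]; ring
          · rw [if_neg fun h => hB h.2, if_neg hB]; ring
        · rw [if_neg fun h => hA h.1, if_neg hA]; ring
      rw [integral_congr_ae key]
      -- The letter `i` only decides which factor of the product contains `u`; the two cases differ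
      -- by a swap.
      cases i
      · rfl
      · exact integral_prod_swap (fun p : (Word → ℝ) × (Word → ℝ) => s ^ pop (t - e) p.1 *
          (if SplitsFirst (t - e) u p.1 then g (split u p.1 - (t - e)) else 0) *
          (s ^ pop (t - e) p.2 * (if Quiet (t - e) (split u p.1 - (t - e)) p.2 then 1 else 0)))

/-! ### The joint generating function in closed form. -/

/-- The joint generating function of the size of the population at time `t` and of the depth of the
first fragment to split after time `t`. -/
noncomputable def jointPGF (s z : ℂ) (t : ℝ) : ℂ :=
  s * Real.exp (-t) * ∫ r in Set.Ioi 0,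
    (Real.exp (-r) : ℂ) * Complex.exp (2 * z * popCumulant (s * Real.exp (-r)) t)

/-- With `D = 1 - s e⁻ʳ (1 - e⁻ᵗ)`, the integrand is `e⁻ʳ D ^ (-2z)` and `D'` is proportional to
`e⁻ʳ`. The primitive is thus a multiple of `D ^ (1 - 2z)`, the exponent `2z = 1` being the
logarithmic exception. -/
lemma hasDerivAt_jointPGF_primitive {s z : ℂ} (hs : ‖s‖ = 1) (hz : 2 * z ≠ 1) {t : ℝ} (ht : 0 < t)
    {r : ℝ} (hr : 0 ≤ r) :
    HasDerivAt (fun r : ℝ => Complex.exp ((2 * z - 1) * popCumulant (s * Real.exp (-r)) t) /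
        ((1 - 2 * z) * (s * (1 - Real.exp (-t) : ℝ))))
      ((Real.exp (-r) : ℂ) * Complex.exp (2 * z * popCumulant (s * Real.exp (-r)) t)) r := by
  have hq : ((1 - Real.exp (-t) : ℝ) : ℂ) ≠ 0 := by
    have : 0 < 1 - Real.exp (-t) := by simpa using ht
    exact_mod_cast this.ne'
  have hs0 : s ≠ 0 := by rintro rfl; simp at hs
  have hz' : 1 - 2 * z ≠ 0 := sub_ne_zero.2 hz.symm
  have hden := pgf_denom_ne_zero (norm_mul_exp_neg_le hs.le hr) ht.le
  have h1 : HasDerivAt (fun r : ℝ => ((Real.exp (-r) : ℝ) : ℂ)) (-Real.exp (-r) : ℝ) r := by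
    have := ((hasDerivAt_id r).neg.exp).ofReal_comp
    simpa using this
  have h2 : HasDerivAt (fun r : ℝ => popCumulant (s * Real.exp (-r)) t) _ r :=
    ((((h1.const_mul s).mul_const ((1 - Real.exp (-t) : ℝ) : ℂ)).const_sub 1).clog_real
      (.inl (re_pgf_denom_pos (norm_mul_exp_neg_le hs.le hr) ht.le))).neg
  convert! ((h2.const_mul (2 * z - 1)).cexp).div_const _ using 1
  have h3 : Complex.exp (2 * z * popCumulant (s * Real.exp (-r)) t) =
      Complex.exp ((2 * z - 1) * popCumulant (s * Real.exp (-r)) t) *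
        (1 - s * Real.exp (-r) * (1 - Real.exp (-t) : ℝ))⁻¹ := by
    have : (1 - s * Real.exp (-r) * (1 - Real.exp (-t) : ℝ))⁻¹ =
        Complex.exp (popCumulant (s * Real.exp (-r)) t) := by
      rw [popCumulant, Complex.exp_neg, Complex.exp_log hden]
    rw [this, ← Complex.exp_add]
    congr 1
    ring
  rw [h3]
  push_cast at hden hq ⊢
  field_simp
  ring

lemma integrableOn_jointPGF (s z : ℂ) (hs : ‖s‖ ≤ 1) {t : ℝ} (ht : 0 ≤ t) :
    IntegrableOn (fun r : ℝ => (Real.exp (-r) : ℂ) *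
      Complex.exp (2 * z * popCumulant (s * Real.exp (-r)) t)) (Set.Ioi 0) := by
  refine integrableOn_exp_neg_mul (C := Real.exp (‖2 * z‖ * t)) ?_ fun r hr => ?_
  · unfold popCumulant; fun_prop
  · rw [Complex.norm_exp]
    refine Real.exp_le_exp.2 ((Complex.re_le_norm _).trans ?_)
    rw [norm_mul]
    exact mul_le_mul_of_nonneg_left (norm_popCumulant_le (norm_mul_exp_neg_le hs hr.le) ht)
      (norm_nonneg _)

lemma jointPGF_eq {s z : ℂ} (hs : ‖s‖ = 1) (hz : 2 * z ≠ 1) {t : ℝ} (ht : 0 < t) :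
    jointPGF s z t = Real.exp (-t) * (Complex.exp ((2 * z - 1) * popCumulant s t) - 1) /
      ((2 * z - 1) * (1 - Real.exp (-t) : ℝ)) := by
  have hq : ((1 - Real.exp (-t) : ℝ) : ℂ) ≠ 0 := by
    have : 0 < 1 - Real.exp (-t) := by simpa using ht
    exact_mod_cast this.ne'
  have hs0 : s ≠ 0 := by rintro rfl; simp at hs
  have hz1 : 1 - 2 * z ≠ 0 := sub_ne_zero.2 hz.symm
  have hz2 : 2 * z - 1 ≠ 0 := sub_ne_zero.2 hz
  have hlim : Tendsto (fun r : ℝ =>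
      Complex.exp ((2 * z - 1) * popCumulant (s * Real.exp (-r)) t) /
        ((1 - 2 * z) * (s * (1 - Real.exp (-t) : ℝ)))) atTop
      (nhds (Complex.exp ((2 * z - 1) * popCumulant (s * (0 : ℝ)) t) /
        ((1 - 2 * z) * (s * (1 - Real.exp (-t) : ℝ))))) := by
    have hc : ContinuousAt (fun y : ℝ =>
        Complex.exp ((2 * z - 1) * popCumulant (s * y) t) /
          ((1 - 2 * z) * (s * (1 - Real.exp (-t) : ℝ)))) 0 := by
      unfold popCumulant
      refine ContinuousAt.div_const (ContinuousAt.cexp (continuousAt_const.mul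
        (ContinuousAt.neg (ContinuousAt.clog (by fun_prop) ?_)))) _
      simp
    exact hc.tendsto.comp Real.tendsto_exp_neg_atTop_nhds_zero
  rw [jointPGF, integral_Ioi_of_hasDerivAt_of_tendsto
    (hasDerivAt_jointPGF_primitive hs hz ht le_rfl).continuousAt.continuousWithinAt
    (fun r hr => hasDerivAt_jointPGF_primitive hs hz ht (Set.mem_Ioi.1 hr).le)
    (integrableOn_jointPGF s z hs.le ht.le) hlim]
  have h0 : popCumulant (s * (0 : ℝ)) t = 0 := by simp [popCumulant]
  rw [h0, neg_zero, Real.exp_zero, Complex.ofReal_one, mul_one, mul_zero, Complex.exp_zero]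
  field_simp
  ring

/-- This value is the expected number of words that split first; it yields uniqueness of the
insertion node. -/
lemma jointPGF_one_one {t : ℝ} (ht : 0 < t) : jointPGF 1 1 t = 1 := by
  have hq : ((1 - Real.exp (-t) : ℝ) : ℂ) ≠ 0 := by
    have : 0 < 1 - Real.exp (-t) := by simpa using ht
    exact_mod_cast this.ne'
  have h : popCumulant 1 t = t := by
    rw [popCumulant, one_mul, ← Complex.ofReal_one, ← Complex.ofReal_sub, sub_sub_cancel,
      ← Complex.ofReal_log (Real.exp_pos _).le, Real.log_exp]
    simp
  rw [jointPGF_eq (by simp) (by norm_num) ht, h, div_eq_one_iff_eq (by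
    refine mul_ne_zero (by norm_num) hq)]
  have : (Real.exp (-t) : ℂ) * Complex.exp t = 1 := by
    rw [← Complex.ofReal_exp, ← Complex.ofReal_mul, ← Real.exp_add]; simp
  norm_num at this ⊢
  linear_combination this

/-! ### Summation over words and uniqueness of the first fragment to split. -/

lemma hasSum_word_length {f : ℕ → ℂ} {S : ℂ} (hs : Summable fun n => ‖2 ^ n * f n‖)
    (h : HasSum (fun n => 2 ^ n * f n) S) : HasSum (fun u : Word => f u.length) S := by
  have hsum : Summable (fun u : Word => f u.length) := by
    refine Summable.of_nnnorm (ENNReal.tsum_coe_ne_top_iff_summable.1 ?_)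
    rw [tsum_word_length fun n => (‖f n‖₊ : ENNReal)]
    have := ENNReal.tsum_coe_ne_top_iff_summable.2 ((NNReal.summable_coe (f := fun n => ‖2 ^ n * f n‖₊)).1 hs)
    simpa using this
  have h1 := (Equiv.sigmaFiberEquiv (List.length : Word → ℕ)).hasSum_iff.2 hsum.hasSum
  have h2 := h1.sigma (g := fun n => 2 ^ n * f n) fun n => by
    have hc (c : {l : Word // l.length = n}) : ((fun u : Word => f u.length) ∘
        Equiv.sigmaFiberEquiv (List.length : Word → ℕ)) ⟨n, c⟩ = f n := congrArg f c.2
    let : Fintype {l : Word // l.length = n} := inferInstanceAs (Fintype (List.Vector Bool n))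
    have hcard : Fintype.card {l : Word // l.length = n} = 2 ^ n := by
      have := card_vector (α := Bool) n
      rwa [Fintype.card_bool] at this
    simp_rw [hc]
    convert! hasSum_fintype (fun _ : {l : Word // l.length = n} => f n) using 1
    rw [Finset.sum_const, Finset.card_univ, hcard]
    simp
  rw [← h2.unique h]
  exact hsum.hasSum

open Classical in
-- Grouping words by length produces the exponential series of `2 * z * popCumulant`, dominated by
-- that of `‖2 * z‖ * t` uniformly in `r`.
lemma hasSum_integral_splitsFirst {s z : ℂ} (hs : ‖s‖ ≤ 1) {t : ℝ} (ht : 0 ≤ t) :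
    HasSum (fun u : Word => z ^ u.length *
      ∫ x, s ^ pop t x * (if SplitsFirst t u x then 1 else 0) ∂lifeMeasure) (jointPGF s z t) := by
  have h (u : Word) := integral_pow_pop_splitsFirst hs u (g := fun _ => 1) measurable_const
    (by simp) ht
  simp_rw [h]
  have key : HasSum (fun n : ℕ => ∫ r in Set.Ioi 0, (Real.exp (-r) : ℂ) *
      ((2 * z * popCumulant (s * Real.exp (-r)) t) ^ n / n.factorial))
      (∫ r in Set.Ioi 0,
        (Real.exp (-r) : ℂ) * Complex.exp (2 * z * popCumulant (s * Real.exp (-r)) t)) := by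
    have hexp (r : ℝ) : HasSum (fun n : ℕ => Real.exp (-r) * ((‖2 * z‖ * t) ^ n / n.factorial))
        (Real.exp (-r) * Real.exp (‖2 * z‖ * t)) := by
      rw [Real.exp_eq_exp_ℝ]
      exact (NormedSpace.expSeries_div_hasSum_exp (‖2 * z‖ * t)).mul_left _
    refine hasSum_integral_of_dominated_convergence
      (fun n r => Real.exp (-r) * ((‖2 * z‖ * t) ^ n / n.factorial)) ?_ ?_ ?_ ?_ ?_
    · intro n
      refine Measurable.aestronglyMeasurable ?_
      unfold popCumulant
      fun_prop
    · intro n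
      refine ae_restrict_of_forall_mem measurableSet_Ioi fun r hr => ?_
      rw [norm_mul, Complex.norm_of_nonneg (Real.exp_pos _).le, norm_div, norm_pow, norm_mul,
        Complex.norm_natCast]
      gcongr
      exact norm_popCumulant_le (norm_mul_exp_neg_le hs (Set.mem_Ioi.1 hr).le) ht
    · exact ae_of_all _ fun r => (hexp r).summable
    · simp_rw [fun r => (hexp r).tsum_eq]
      have := integrableOn_exp_mul_Ioi (a := -1) (by norm_num) 0
      simp only [neg_mul, one_mul] at this
      exact this.mul_const _
    · refine ae_of_all _ fun r => ?_
      have h := NormedSpace.expSeries_div_hasSum_exp (2 * z * popCumulant (s * Real.exp (-r)) t)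
      rw [← Complex.exp_eq_exp_ℂ] at h
      exact h.mul_left _
  have key2 := key.mul_left (s * Real.exp (-t))
  have heq (n : ℕ) : s * Real.exp (-t) * ∫ r in Set.Ioi 0, (Real.exp (-r) : ℂ) *
      ((2 * z * popCumulant (s * Real.exp (-r)) t) ^ n / n.factorial) =
      2 ^ n * (z ^ n * (s * Real.exp (-t) * ∫ r in Set.Ioi 0, (Real.exp (-r) : ℂ) *
        (1 * (popCumulant (s * Real.exp (-r)) t ^ n / n.factorial)))) := by
    have : (fun r : ℝ => (Real.exp (-r) : ℂ) *
        ((2 * z * popCumulant (s * Real.exp (-r)) t) ^ n / n.factorial)) = fun r => (2 ^ n * z ^ n) *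
        ((Real.exp (-r) : ℂ) * (1 * (popCumulant (s * Real.exp (-r)) t ^ n / n.factorial))) := by
      ext r
      ring
    rw [this, integral_const_mul]
    ring
  simp_rw [heq] at key2
  exact hasSum_word_length (f := fun n => z ^ n * (s * Real.exp (-t) * ∫ r in Set.Ioi 0,
    (Real.exp (-r) : ℂ) * (1 * (popCumulant (s * Real.exp (-r)) t ^ n / n.factorial))))
    key2.summable.norm key2

lemma exists_splitsFirst {t : ℝ} (ht : 0 ≤ t) {x : Word → ℝ} (hf : {u | birth u x ≤ t}.Finite) :
    ∃ u, SplitsFirst t u x := by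
  have hfin : (alive t x).Finite := hf.subset fun u hu => hu.1
  obtain ⟨u, hu, hmin⟩ := hfin.exists_minimalFor (fun u => split u x) _ (alive_nonempty ht hf)
  refine ⟨u, hu, fun v hv => ?_⟩
  rw [add_sub_cancel]
  by_contra! hlt
  exact absurd (hmin hv hlt.le) (not_le.2 hlt)

open Classical in
-- The number of fragments that split first is almost surely at least `1` by finiteness of the tree,
-- and its expectation is `1`. It is therefore almost surely `1`, and ties need no separate
-- treatment.
lemma ae_existsUnique_splitsFirst {t : ℝ} (ht : 0 < t) :
    ∀ᵐ x ∂lifeMeasure, ∃! u, SplitsFirst t u x := by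
  have h1 : ∫⁻ x, ∑' u, {x | SplitsFirst t u x}.indicator (1 : (Word → ℝ) → ENNReal) x
      ∂lifeMeasure = 1 := by
    rw [lintegral_tsum fun u =>
      (measurable_one.indicator (measurableSet_splitsFirst t u)).aemeasurable]
    simp_rw [fun u => lintegral_indicator_one (μ := lifeMeasure) (measurableSet_splitsFirst t u)]
    have h := hasSum_integral_splitsFirst (s := 1) (z := 1) (by simp) ht.le
    rw [jointPGF_one_one ht] at h
    have hr (u : Word) : (1 : ℂ) ^ u.length * ∫ x, (1 : ℂ) ^ pop t x *
        (if SplitsFirst t u x then 1 else 0) ∂lifeMeasure =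
        ((lifeMeasure.real {x | SplitsFirst t u x} : ℝ) : ℂ) := by
      have : (fun x => (1 : ℂ) ^ pop t x * (if SplitsFirst t u x then 1 else 0)) =
          {x | SplitsFirst t u x}.indicator fun _ => 1 := by
        ext x
        simp [Set.indicator_apply]
      rw [this, integral_indicator_const _ (measurableSet_splitsFirst t u)]
      simp
    simp_rw [hr] at h
    have h' : HasSum (fun u => lifeMeasure.real {x | SplitsFirst t u x}) 1 := by
      rw [← Complex.ofReal_one] at h
      exact Complex.hasSum_ofReal.1 h
    have := ENNReal.ofReal_tsum_of_nonneg (fun u => measureReal_nonneg) h'.summable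
    rw [h'.tsum_eq] at this
    simpa [ofReal_measureReal] using this.symm
  have h2 : (fun _ => 1) ≤ᵐ[lifeMeasure]
      fun x => ∑' u, {x | SplitsFirst t u x}.indicator (1 : (Word → ℝ) → ENNReal) x := by
    filter_upwards [ae_finite_tree] with x hx
    obtain ⟨u, hu⟩ := exists_splitsFirst ht.le (hx t)
    refine le_trans ?_ (ENNReal.le_tsum u)
    simp [hu]
  have h3 := ae_eq_of_ae_le_of_lintegral_le h2 (by simp)
    (AEMeasurable.tsum fun u =>
      (measurable_one.indicator (measurableSet_splitsFirst t u)).aemeasurable) (by simp [h1])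
  filter_upwards [h3, ae_finite_tree] with x hx hfin
  obtain ⟨u, hu⟩ := exists_splitsFirst ht.le (hfin t)
  refine ⟨u, hu, fun v hv => ?_⟩
  by_contra hne
  have hle := ENNReal.sum_le_tsum (f := fun u =>
    {x | SplitsFirst t u x}.indicator (1 : (Word → ℝ) → ENNReal) x) {u, v}
  rw [← hx, Finset.sum_pair (Ne.symm hne)] at hle
  simp only [Set.indicator_of_mem (s := {x | SplitsFirst t u x}) hu,
    Set.indicator_of_mem (s := {x | SplitsFirst t v x}) hv, Pi.one_apply] at hle
  norm_num at hle

/-- The depth of the first fragment to split after time `t`. -/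
noncomputable def firstDepth (t : ℝ) (x : Word → ℝ) : ℕ :=
  sInf (List.length '' {u | SplitsFirst t u x})

open Classical in
lemma integral_pow_pop_mul_pow_firstDepth {s z : ℂ} (hs : ‖s‖ ≤ 1) (hz : ‖z‖ ≤ 1) {t : ℝ}
    (ht : 0 < t) :
    ∫ x, s ^ pop t x * z ^ firstDepth t x ∂lifeMeasure = jointPGF s z t := by
  refine HasSum.unique ?_ (hasSum_integral_splitsFirst hs ht.le)
  simp_rw [← integral_const_mul]
  have hone : ∀ᵐ x ∂lifeMeasure,
      HasSum (fun u => if SplitsFirst t u x then (1 : ℝ) else 0) 1 := by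
    filter_upwards [ae_existsUnique_splitsFirst ht] with x ⟨u, hu, huniq⟩
    exact hasSum_of_eq_zero u (if_pos hu) fun v hv => if_neg fun h => hv (huniq v h)
  refine hasSum_integral_of_dominated_convergence
    (fun u x => if SplitsFirst t u x then (1 : ℝ) else 0) ?_ ?_ ?_ ?_ ?_
  · intro u
    have h1 : Measurable fun x => if SplitsFirst t u x then (1 : ℂ) else 0 :=
      Measurable.ite (measurableSet_splitsFirst t u) measurable_const measurable_const
    have h2 : Measurable fun x => s ^ pop t x :=
      (measurable_from_top (f := fun n : ℕ => s ^ n)).comp (measurable_pop t)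
    exact ((h2.mul h1).const_mul _).aestronglyMeasurable
  · refine fun u => ae_of_all _ fun x => ?_
    rw [norm_mul, norm_mul, norm_pow, norm_pow, ← mul_assoc]
    refine (mul_le_of_le_one_left (norm_nonneg _) (mul_le_one₀ (pow_le_one₀ (norm_nonneg _) hz)
      (by positivity) (pow_le_one₀ (norm_nonneg _) hs))).trans ?_
    split_ifs <;> simp
  · exact hone.mono fun x hx => hx.summable
  · refine (integrable_const (1 : ℝ)).congr ?_
    exact hone.mono fun x hx => hx.tsum_eq.symm
  · filter_upwards [ae_existsUnique_splitsFirst ht] with x ⟨u, hu, huniq⟩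
    have hset : {u | SplitsFirst t u x} = {u} := by
      ext v
      exact ⟨fun h => huniq v h, fun h => by rw [Set.mem_singleton_iff.1 h]; exact hu⟩
    refine hasSum_of_eq_zero u ?_ fun v hv => ?_
    · rw [if_pos hu, firstDepth, hset]
      simp [mul_comm]
    · rw [if_neg fun h => hv (huniq v h)]
      simp

/-! ### Identification with the leaves and the insertion node of the tree. -/

lemma leaves_tree_eq_alive {x : Word → ℝ} (hx : ∀ u, 0 < x u) (t : ℝ) :
    leaves (tree (fun v (y : Word → ℝ) => y v) t x) = alive t x := by
  ext u
  refine and_congr_right fun _ => ⟨fun h => ?_, fun h v hv hmem => ?_⟩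
  · have : ¬ birth (u ++ [true]) x ≤ t := h [true] (by simp)
    rwa [birth_append_singleton, not_le] at this
  · obtain ⟨i, v, rfl⟩ := List.exists_cons_of_ne_nil hv
    have h1 : birth (u ++ i :: v) x ≤ t := hmem
    have h2 := birth_le_birth_append hx (u ++ [i]) v
    rw [birth_append_singleton, List.append_assoc, List.singleton_append] at h2
    linarith

/-- On the path from the root to a node born after `t` there is a fragment alive at time `t`, which
has to split before that node is born. -/
lemma exists_mem_alive_split_le {x : Word → ℝ} (hx : ∀ u, 0 < x u) {t : ℝ} (ht : 0 ≤ t) {w : Word}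
    (hw : t < birth w x) : ∃ v ∈ alive t x, split v x ≤ birth w x := by
  induction w using List.reverseRecOn with
  | nil => simp at hw; linarith
  | append_singleton v i ih =>
    rw [birth_append_singleton] at hw ⊢
    by_cases hv : birth v x ≤ t
    · exact ⟨v, ⟨hv, hw⟩, le_rfl⟩
    · obtain ⟨v', hv', hle⟩ := ih (not_le.1 hv)
      have := hx v
      exact ⟨v', hv', hle.trans (by simp only [split]; linarith)⟩

/-- The tree grows at each splitting time of a living fragment, and by `exists_mem_alive_split_le`
not before the earliest of them. Hence both children of a leaf belong to the tree at the next growth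
time exactly when no living fragment splits earlier. -/
lemma insertionNode_eq_splitsFirst {x : Word → ℝ} (hx : ∀ u, 0 < x u) (t : ℝ) :
    insertionNode (fun v (y : Word → ℝ) => y v) t x = {u | SplitsFirst t u x} := by
  ext u
  simp only [insertionNode, leaves_tree_eq_alive hx, Set.mem_ofPred_eq, SplitsFirst]
  refine and_congr_right fun hu => ?_
  have ht : 0 ≤ t := (birth_nonneg hx u).trans hu.1
  have hmem (i : Bool) (s : ℝ) :
      u ++ [i] ∈ tree (fun v (y : Word → ℝ) => y v) s x ↔ split u x ≤ s := by
    rw [← birth_append_singleton u i]; rfl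
  rw [hmem, hmem, and_self]
  have hgrow (v : Word) (hv : v ∈ alive t x) : split v x ∈ {s | t < s ∧
      tree (fun v (y : Word → ℝ) => y v) s x ≠ tree (fun v (y : Word → ℝ) => y v) t x} := by
    refine ⟨hv.2, fun h => ?_⟩
    have h1 : v ++ [true] ∈ tree (fun v (y : Word → ℝ) => y v) (split v x) x :=
      (birth_append_singleton v true x).le
    rw [h] at h1
    have h2 : birth (v ++ [true]) x ≤ t := h1
    rw [birth_append_singleton] at h2
    exact absurd hv.2 (not_lt.2 h2)
  constructor
  · intro h v hv
    rw [add_sub_cancel]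
    exact h.trans (csInf_le ⟨t, fun s hs => hs.1.le⟩ (hgrow v hv))
  · intro h
    refine le_csInf ⟨_, hgrow u hu⟩ fun s hs => ?_
    obtain ⟨hts, hne⟩ := hs
    have : ∃ w, birth w x ≤ s ∧ t < birth w x := by
      by_contra! hcon
      refine hne (Set.Subset.antisymm (fun w hw => ?_) fun w hw => ?_)
      · exact hcon w hw
      · exact le_trans (show birth w x ≤ t from hw) hts.le
    obtain ⟨w, hws, hwt⟩ := this
    obtain ⟨v, hv, hle⟩ := exists_mem_alive_split_le hx ht hwt
    have := h v hv
    rw [add_sub_cancel] at this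
    exact this.trans (hle.trans hws)

lemma measurable_firstDepth (t : ℝ) : Measurable (firstDepth t) := by
  refine measurable_of_Ici fun n => ?_
  -- The infimum of the empty set is `0` in `ℕ`, so outcomes without a first fragment count only for
  -- `n = 0`.
  have : firstDepth t ⁻¹' Set.Ici n = {_x | n = 0} ∪ ((⋃ u, {x | SplitsFirst t u x}) ∩
      ⋂ u : Word, ({x | SplitsFirst t u x}ᶜ ∪ {_x | n ≤ u.length})) := by
    ext x
    simp only [firstDepth, Set.mem_preimage, Set.mem_Ici, Set.mem_ofPred_eq, Set.mem_union,
      Set.mem_inter_iff, Set.mem_iUnion, Set.mem_iInter, Set.mem_compl_iff, ← imp_iff_not_or]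
    by_cases h : ∃ u, SplitsFirst t u x
    · have hne : (List.length '' {u | SplitsFirst t u x}).Nonempty := Set.Nonempty.image _ h
      rw [le_csInf_iff (OrderBot.bddBelow _) hne]
      simp only [Set.forall_mem_image, Set.mem_ofPred_eq, h, true_and]
      constructor
      · exact .inr
      · rintro (rfl | h)
        · exact fun _ _ => Nat.zero_le _
        · exact h
    · have hempty : {u | SplitsFirst t u x} = ∅ := by
        ext u
        exact ⟨fun hu => h ⟨u, hu⟩, False.elim⟩
      rw [hempty]
      simp [h]
  rw [this]
  exact .union (.const _) (.inter (.iUnion fun u => measurableSet_splitsFirst t u)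
    (.iInter fun u => (measurableSet_splitsFirst t u).compl.union (.const _)))

/-! ### Asymptotics of the characteristic function. -/

lemma tendsto_exp_sub_one_mul (b : ℝ) :
    -- With `q = √(2t)`, so that `t = q² / 2`, the second-order expansion of `exp (i b / q)` gives
    -- `i b q - b² / 2`. The cubic remainder contributes at most `q² (|b| / q)³ = |b|³ / q`.
    Tendsto (fun t : ℝ => (2 * Complex.exp ((b / √(2 * t) : ℝ) * Complex.I) - 2) * t -
      (b * √(2 * t) : ℝ) * Complex.I) atTop (nhds (-(b ^ 2 / 2 : ℝ))) := by
  have hsqrt : Tendsto (fun t : ℝ => √(2 * t)) atTop atTop :=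
    Real.tendsto_sqrt_atTop.comp (tendsto_id.const_mul_atTop two_pos)
  have hy : Tendsto (fun t : ℝ => b / √(2 * t)) atTop (nhds 0) :=
    hsqrt.const_div_atTop b
  rw [tendsto_iff_norm_sub_tendsto_zero]
  refine squeeze_zero' (g := fun t => |b| ^ 3 * (√(2 * t))⁻¹) (.of_forall fun _ => norm_nonneg _)
    ?_ ?_
  · filter_upwards [eventually_gt_atTop 0,
      (hy.norm.eventually_le_const (show ‖(0 : ℝ)‖ < 1 by simp))] with t ht hle
    set q := √(2 * t) with hq
    have hqpos : 0 < q := Real.sqrt_pos.2 (by linarith)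
    have hq2 : q ^ 2 = 2 * t := Real.sq_sqrt (by linarith)
    have hn : ‖((b / q : ℝ) : ℂ) * Complex.I‖ = |b| / q := by
      rw [norm_mul, Complex.norm_I, mul_one, Complex.norm_real, Real.norm_eq_abs, abs_div,
        abs_of_pos hqpos]
    have hb : ‖((b / q : ℝ) : ℂ) * Complex.I‖ ≤ 1 := by
      rwa [norm_mul, Complex.norm_I, mul_one, Complex.norm_real]
    have h := Complex.exp_bound hb (n := 3) (by norm_num)
    rw [hn] at h
    have hqc : (q : ℂ) ≠ 0 := by exact_mod_cast hqpos.ne'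
    have ht' : (t : ℂ) = (q : ℂ) ^ 2 / 2 := by
      rw [← Complex.ofReal_pow, hq2]; push_cast; ring
    have heq : (2 * Complex.exp ((b / q : ℝ) * Complex.I) - 2) * t - (b * q : ℝ) * Complex.I -
        -((b ^ 2 / 2 : ℝ) : ℂ) = (q ^ 2 : ℝ) * (Complex.exp ((b / q : ℝ) * Complex.I) -
        ∑ m ∈ Finset.range 3, ((b / q : ℝ) * Complex.I) ^ m / m.factorial) := by
      rw [ht']
      simp only [Finset.sum_range_succ, Finset.sum_range_zero, mul_pow, Complex.I_sq]
      push_cast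
      field_simp
      norm_num [Nat.factorial]
      ring
    rw [heq, norm_mul, Complex.norm_of_nonneg (by positivity)]
    calc q ^ 2 * _ ≤ q ^ 2 * ((|b| / q) ^ 3 * 1) := by
          refine mul_le_mul_of_nonneg_left (h.trans ?_) (by positivity)
          refine mul_le_mul_of_nonneg_left ?_ (by positivity)
          norm_num [Nat.factorial]
      _ = |b| ^ 3 * q⁻¹ := by
          field_simp
  · have := (tendsto_inv_atTop_zero.comp hsqrt).const_mul (|b| ^ 3)
    simpa using this

/-- The first term is minus the difference quotient of `h ↦ exp (i a h)` at `0` with step `h = exp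
(-t)`. -/
lemma tendsto_exp_mul_one_sub_exp (a : ℝ) :
    Tendsto (fun t : ℝ => (Real.exp t : ℂ) *
      (1 - Complex.exp ((a * Real.exp (-t) : ℝ) * Complex.I)) +
        Complex.exp ((a * Real.exp (-t) : ℝ) * Complex.I)) atTop (nhds (1 - a * Complex.I)) := by
  have hd : HasDerivAt (fun h : ℝ => Complex.exp ((a * h : ℝ) * Complex.I)) (a * Complex.I) 0 := by
    have h1 : HasDerivAt (fun h : ℝ => ((a * h : ℝ) : ℂ)) (a : ℂ) 0 := by
      have := ((hasDerivAt_id (0 : ℝ)).const_mul a).ofReal_comp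
      simpa using this
    have := (h1.mul_const Complex.I).cexp
    simpa using this
  have hexp : Tendsto (fun t : ℝ => Real.exp (-t)) atTop (nhdsWithin 0 {0}ᶜ) :=
    tendsto_nhdsWithin_iff.2 ⟨Real.tendsto_exp_neg_atTop_nhds_zero,
      .of_forall fun t => (Real.exp_pos _).ne'⟩
  have h1 := hd.tendsto_slope_zero.comp hexp
  have h2 := hd.continuousAt.tendsto.comp Real.tendsto_exp_neg_atTop_nhds_zero
  have h3 := h2.sub h1
  simp only [Function.comp_def, mul_zero, Complex.ofReal_zero, zero_mul, Complex.exp_zero,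
    zero_add] at h3
  refine h3.congr fun t => ?_
  rw [← Real.exp_neg, neg_neg, Complex.real_smul]
  ring

/-- The characteristic function of the rescaled pair converges. -/
lemma tendsto_jointPGF (a b : ℝ) :
    Tendsto (fun t : ℝ => Complex.exp (-((b * √(2 * t) : ℝ) * Complex.I)) *
      jointPGF (Complex.exp ((a * Real.exp (-t) : ℝ) * Complex.I))
        (Complex.exp ((b / √(2 * t) : ℝ) * Complex.I)) t) atTop
      (nhds ((1 - a * Complex.I)⁻¹ * Complex.exp (-(b ^ 2 / 2 : ℝ)))) := by
  set s : ℝ → ℂ := fun t => Complex.exp ((a * Real.exp (-t) : ℝ) * Complex.I) with hs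
  set z : ℝ → ℂ := fun t => Complex.exp ((b / √(2 * t) : ℝ) * Complex.I) with hz
  -- This is `exp t` times the denominator `1 - s (1 - exp (-t))`, so that `popCumulant (s t) t = t
  -- - log (w t)`.
  set w : ℝ → ℂ := fun t => (Real.exp t : ℂ) * (1 - s t) + s t with hw
  have hsn (t : ℝ) : ‖s t‖ = 1 := Complex.norm_exp_ofReal_mul_I _
  have hwlim : Tendsto w atTop (nhds (1 - a * Complex.I)) := tendsto_exp_mul_one_sub_exp a
  have hre : 0 < (1 - a * Complex.I).re := by simp
  have hne : (1 - a * Complex.I) ≠ 0 := fun h => by simp [h] at hre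
  have hsqrt : Tendsto (fun t : ℝ => √(2 * t)) atTop atTop :=
    Real.tendsto_sqrt_atTop.comp (tendsto_id.const_mul_atTop two_pos)
  have hzlim : Tendsto z atTop (nhds 1) := by
    have h1 : Tendsto (fun t : ℝ => b / √(2 * t)) atTop (nhds 0) := hsqrt.const_div_atTop b
    have h2 : ContinuousAt (fun y : ℝ => Complex.exp ((y : ℂ) * Complex.I)) 0 := by fun_prop
    have h3 := h2.tendsto.comp h1
    rwa [Complex.ofReal_zero, zero_mul, Complex.exp_zero] at h3
  have hqlim : Tendsto (fun t : ℝ => ((1 - Real.exp (-t) : ℝ) : ℂ)) atTop (nhds 1) := by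
    have := (Complex.continuous_ofReal.tendsto _).comp
      (Real.tendsto_exp_neg_atTop_nhds_zero.const_sub 1)
    simpa [Function.comp_def] using this
  have hden : Tendsto (fun t : ℝ => (2 * z t - 1) * (1 - Real.exp (-t) : ℝ)) atTop (nhds 1) := by
    have := ((hzlim.const_mul 2).sub_const 1).mul hqlim
    norm_num at this ⊢
    exact this
  -- The contribution of the term `-1` in the numerator of the closed form.
  have hsmall : Tendsto (fun t : ℝ => Complex.exp (-((b * √(2 * t) : ℝ) * Complex.I)) *
      Real.exp (-t)) atTop (nhds 0) := by
    rw [tendsto_zero_iff_norm_tendsto_zero]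
    refine Real.tendsto_exp_neg_atTop_nhds_zero.congr fun t => ?_
    rw [norm_mul, ← neg_mul, ← Complex.ofReal_neg, Complex.norm_exp_ofReal_mul_I, one_mul,
      Complex.norm_of_nonneg (Real.exp_pos _).le]
  have hmain : Tendsto (fun t : ℝ => Complex.exp ((2 * z t - 2) * t -
      (b * √(2 * t) : ℝ) * Complex.I) * Complex.exp (-((2 * z t - 1) * Complex.log (w t)))) atTop
      (nhds (Complex.exp (-(b ^ 2 / 2 : ℝ)) * (1 - a * Complex.I)⁻¹)) := by
    refine Tendsto.mul ((Complex.continuous_exp.tendsto _).comp (tendsto_exp_sub_one_mul b)) ?_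
    have h1 := (((hzlim.const_mul 2).sub_const 1).mul (hwlim.clog (.inl hre))).neg.cexp
    convert! h1 using 2
    rw [← Complex.exp_log hne, ← Complex.exp_neg, Complex.exp_log hne]
    norm_num
  have hfin := (hmain.sub hsmall).div hden one_ne_zero
  rw [sub_zero, div_one, mul_comm (Complex.exp _)] at hfin
  refine hfin.congr' ?_
  have hz1 : ∀ᶠ t in atTop, 2 * z t ≠ 1 := by
    have := hzlim.const_mul 2
    exact this.eventually_ne (by norm_num)
  have hw0 : ∀ᶠ t in atTop, w t ≠ 0 := hwlim.eventually_ne hne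
  filter_upwards [hz1, hw0, eventually_gt_atTop 0] with t hzt hwt ht
  rw [Pi.div_apply, jointPGF_eq (hsn t) hzt ht]
  have hcum : popCumulant (s t) t = t - Complex.log (w t) := by
    have : 1 - s t * (1 - Real.exp (-t) : ℝ) = (Real.exp (-t) : ℝ) * w t := by
      have h : (Real.exp (-t) : ℂ) * Real.exp t = 1 := by
        rw [← Complex.ofReal_mul, ← Real.exp_add]; simp
      simp only [hw]
      push_cast at h ⊢
      linear_combination (s t - 1) * h
    rw [popCumulant, this, Complex.log_ofReal_mul (Real.exp_pos _) hwt, Real.log_exp]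
    push_cast
    ring
  have hexp : Complex.exp ((2 * z t - 2) * t - (b * √(2 * t) : ℝ) * Complex.I) *
      Complex.exp (-((2 * z t - 1) * Complex.log (w t))) =
      Complex.exp (-((b * √(2 * t) : ℝ) * Complex.I)) * (Real.exp (-t) *
        Complex.exp ((2 * z t - 1) * popCumulant (s t) t)) := by
    rw [hcum, Complex.ofReal_exp, ← Complex.exp_add, ← Complex.exp_add, ← Complex.exp_add]
    congr 1
    push_cast
    ring
  rw [hexp]
  ring

lemma charFun_expMeasure_one (a : ℝ) : charFun (expMeasure 1) a = (1 - a * Complex.I)⁻¹ := by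
  rw [charFun_apply_real, integral_expMeasure_one]
  have h : (fun e : ℝ => (Real.exp (-e) : ℂ) * Complex.exp (a * e * Complex.I)) =
      fun e : ℝ => Complex.exp ((-1 + a * Complex.I) * e) := by
    ext e
    rw [Complex.ofReal_exp, ← Complex.exp_add]
    congr 1
    push_cast
    ring
  rw [h, integral_exp_mul_complex_Ioi (by simp), Complex.ofReal_zero, mul_zero, Complex.exp_zero,
    neg_div, one_div, ← inv_neg]
  congr 1
  ring

/-! ### Lévy's theorem for pairs and transfer to the given probability space. -/

lemma tendstoInDistribution_prodMk_of_charFun {Ω Ω' : Type*} [MeasurableSpace Ω]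
    [MeasurableSpace Ω'] {P : Measure Ω} [IsProbabilityMeasure P] {P' : Measure Ω'}
    [IsProbabilityMeasure P'] {X Y : ℝ → Ω → ℝ} {ξ G : Ω' → ℝ}
    (hX : ∀ t, AEMeasurable (X t) P) (hY : ∀ t, AEMeasurable (Y t) P)
    (hξ : AEMeasurable ξ P') (hG : AEMeasurable G P') (hind : IndepFun ξ G P')
    (h : ∀ a b : ℝ, Tendsto (fun t => ∫ ω, Complex.exp ((a * X t ω + b * Y t ω : ℝ) * Complex.I) ∂P)
      atTop (nhds (charFun (P'.map ξ) a * charFun (P'.map G) b))) :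
    TendstoInDistribution (fun t ω => (X t ω, Y t ω)) atTop (fun ω' => (ξ ω', G ω'))
      (fun _ => P) P' := by
  -- Characteristic functions are taken on an inner product space, so the pair is moved to the
  -- Euclidean plane and brought back by continuity at the end.
  have hm : Measurable (WithLp.toLp 2 : ℝ × ℝ → WithLp 2 (ℝ × ℝ)) :=
    (MeasurableEquiv.toLp 2 (ℝ × ℝ)).measurable
  have hXY (t : ℝ) : AEMeasurable (fun ω => WithLp.toLp 2 (X t ω, Y t ω)) P :=
    hm.comp_aemeasurable ((hX t).prodMk (hY t))
  have hZ : AEMeasurable (fun ω' => WithLp.toLp 2 (ξ ω', G ω')) P' :=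
    hm.comp_aemeasurable (hξ.prodMk hG)
  have key : TendstoInDistribution (fun t ω => WithLp.toLp 2 (X t ω, Y t ω)) atTop
      (fun ω' => WithLp.toLp 2 (ξ ω', G ω')) (fun _ => P) P' := by
    refine ⟨hXY, hZ, tendsto_of_seq_tendsto fun ts hts => ?_⟩
    refine ProbabilityMeasure.tendsto_iff_tendsto_charFun.2 fun v => ?_
    have hlim : charFun (P'.map fun ω' => WithLp.toLp 2 (ξ ω', G ω')) v =
        charFun (P'.map ξ) v.fst * charFun (P'.map G) v.snd := by
      have := (indepFun_iff_map_prod_eq_prod_map_map hξ hG).1 hind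
      have hprod := charFun_prod (μ := P'.map ξ) (ν := P'.map G) v
      rw [← this, AEMeasurable.map_map_of_aemeasurable hm.aemeasurable (hξ.prodMk hG)] at hprod
      exact hprod
    have hpre (t : ℝ) : charFun (P.map fun ω => WithLp.toLp 2 (X t ω, Y t ω)) v =
        ∫ ω, Complex.exp ((v.fst * X t ω + v.snd * Y t ω : ℝ) * Complex.I) ∂P := by
      rw [charFun_apply, integral_map (hXY t) (by fun_prop)]
      simp only [WithLp.prod_inner_apply]
      rfl
    have hconv : Tendsto (fun n => charFun
        (P.map fun ω => WithLp.toLp 2 (X (ts n) ω, Y (ts n) ω)) v) atTop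
        (nhds (charFun (P'.map fun ω' => WithLp.toLp 2 (ξ ω', G ω')) v)) := by
      rw [hlim]
      simp_rw [hpre]
      exact (h v.fst v.snd).comp hts
    exact hconv
  exact key.continuous_comp (g := WithLp.ofLp) (WithLp.prod_continuous_ofLp 2 ℝ ℝ)

lemma ae_numLeaves_insertionDepth {Ω : Type*} [MeasurableSpace Ω] {P : Measure Ω}
    {life : Word → Ω → ℝ} (hlife : HasLaw (fun ω u => life u ω) lifeMeasure P) (t : ℝ) :
    ∀ᵐ ω ∂P, numLeaves life t ω = pop t (fun u => life u ω) ∧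
      insertionDepth life t ω = firstDepth t (fun u => life u ω) := by
  have h : ∀ᵐ x ∂lifeMeasure, numLeaves (fun v (y : Word → ℝ) => y v) t x = pop t x ∧
      insertionDepth (fun v (y : Word → ℝ) => y v) t x = firstDepth t x := by
    filter_upwards [ae_pos] with x hx
    rw [numLeaves, leaves_tree_eq_alive hx, insertionDepth, insertionNode_eq_splitsFirst hx]
    exact ⟨rfl, rfl⟩
  rw [← hlife.map_eq] at h
  exact ae_of_ae_map hlife.aemeasurable h

end YuleTree

theorem proposition5p3
    {Ω : Type*} [MeasurableSpace Ω] (P : Measure Ω) [IsProbabilityMeasure P]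
    (life : YuleTree.Word → Ω → ℝ)
    (hindep : iIndepFun life P)
    (hlaw : ∀ u : YuleTree.Word, HasLaw (life u) (expMeasure 1) P)
    {Ω' : Type*} [MeasurableSpace Ω'] (P' : Measure Ω') [IsProbabilityMeasure P']
    (ξ G : Ω' → ℝ)
    (hξ : HasLaw ξ (expMeasure 1) P')
    (hG : HasLaw G (gaussianReal 0 1) P')
    (hξG : IndepFun ξ G P') :
    TendstoInDistribution
      (fun (t : ℝ) (ω : Ω) =>
        ((YuleTree.numLeaves life t ω : ℝ) * Real.exp (-t),
          ((YuleTree.insertionDepth life t ω : ℝ) - 2 * t) / Real.sqrt (2 * t)))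
      atTop
      (fun ω' => (ξ ω', G ω'))
      (fun _ => P) P' := by
  have hlife : HasLaw (fun ω u => life u ω) YuleTree.lifeMeasure P :=
    hindep.hasLaw_infinitePi hlaw (aemeasurable_pi_iff.2 fun u => (hlaw u).aemeasurable)
  have hae := YuleTree.ae_numLeaves_insertionDepth hlife
  have hN (t : ℝ) : AEMeasurable (fun ω => (YuleTree.numLeaves life t ω : ℝ)) P := by
    have h1 : Measurable fun x => (YuleTree.pop t x : ℝ) :=
      (measurable_from_top (f := fun n : ℕ => (n : ℝ))).comp (YuleTree.measurable_pop t)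
    refine (h1.comp_aemeasurable hlife.aemeasurable).congr ?_
    filter_upwards [hae t] with ω hω
    simp [hω.1]
  have hd (t : ℝ) : AEMeasurable (fun ω => (YuleTree.insertionDepth life t ω : ℝ)) P := by
    have h1 : Measurable fun x => (YuleTree.firstDepth t x : ℝ) :=
      (measurable_from_top (f := fun n : ℕ => (n : ℝ))).comp (YuleTree.measurable_firstDepth t)
    refine (h1.comp_aemeasurable hlife.aemeasurable).congr ?_
    filter_upwards [hae t] with ω hω
    simp [hω.2]
  refine YuleTree.tendstoInDistribution_prodMk_of_charFun (fun t => (hN t).mul_const _)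
    (fun t => ((hd t).sub_const _).div_const _) hξ.aemeasurable hG.aemeasurable hξG fun a b => ?_
  rw [hξ.map_eq, hG.map_eq, YuleTree.charFun_expMeasure_one, charFun_gaussianReal]
  convert! (YuleTree.tendsto_jointPGF a b).congr' ?_ using 2
  · congr 2
    push_cast
    ring
  filter_upwards [eventually_gt_atTop 0] with t ht
  rw [← YuleTree.integral_pow_pop_mul_pow_firstDepth
    (Complex.norm_exp_ofReal_mul_I _).le (Complex.norm_exp_ofReal_mul_I _).le ht,
    ← integral_const_mul]
  have hm : Measurable fun x => Complex.exp (-((b * √(2 * t) : ℝ) * Complex.I)) *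
      (Complex.exp ((a * Real.exp (-t) : ℝ) * Complex.I) ^ YuleTree.pop t x *
        Complex.exp ((b / √(2 * t) : ℝ) * Complex.I) ^ YuleTree.firstDepth t x) := by
    have h1 (s : ℂ) : Measurable fun x => s ^ YuleTree.pop t x :=
      (measurable_from_top (f := fun n : ℕ => s ^ n)).comp (YuleTree.measurable_pop t)
    have h2 (s : ℂ) : Measurable fun x => s ^ YuleTree.firstDepth t x :=
      (measurable_from_top (f := fun n : ℕ => s ^ n)).comp (YuleTree.measurable_firstDepth t)
    exact ((h1 _).mul (h2 _)).const_mul _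
  rw [← hlife.map_eq, integral_map hlife.aemeasurable hm.aestronglyMeasurable]
  refine integral_congr_ae ?_
  filter_upwards [hae t] with ω hω
  have hq : 0 < √(2 * t) := Real.sqrt_pos.2 (by linarith)
  -- The centring `2t` becomes `√(2t)` after scaling, hence the prefactor `exp (-i b √(2t))`.
  have hq2 : (2 * t) / √(2 * t) = √(2 * t) := Real.div_sqrt
  rw [← Complex.exp_nat_mul, ← Complex.exp_nat_mul, ← Complex.exp_add, ← Complex.exp_add, hω.1,
    hω.2, sub_div, hq2]
  congr 1
  push_cast
  ring
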